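/- **Strong proximity lattices.** A strong proximity lattice $(S,\prec)$ is a distributive lattice $S$ with $0,1$ together with a relation $\prec$ on $S$ such that: $\{a\mid a\prec b\}$ is an ideal and $\{a \mid b\prec a\}$ is a filter for every $b$; ${\prec}\circ{\prec}={\prec}$; $a\prec 0$ implies $a=0$; $1\prec a$ implies $a=1$; if $a\prec b\vee c$ then $a\le b'\vee c'$ for some $b'\prec b$, $c'\prec c$; if $b\wedge c\prec a$ then $b'\wedge c'\le a$ for some $b'\succ b$, $c'\succ c$. **Strong continuous entailment relations.** Let $\mathrm{Fin}(S)$ be the set of finite subsets of $S$. An entailment relation on $S$ is a relation $\vdash$ on $\mathrm{Fin}(S)$ such that $\{a\}\vdash \{a\}$; $A\vdash B$ implies $A\cup A'\vdash B\cup B'$; and $A\vdash B\cup\{a\}$, $\{a\}\cup A\vdash B$ imply $A\vdash B$. For a relation $\prec$ on $S$ put $A\prec_L B\iff\forall a\in A\,\exists b\in B\,(a\prec b)$ and $A\prec_U B\iff\forall b\in B\,\exists a\in A\,(a\prec b)$. A strong continuous entailment relation $(S,\vdash,\prec)$ is an entailment relation $(S,\vdash)$ with a relation $\prec$ on $S$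 satisfying ${\prec}\circ{\prec}={\prec}$ and, for all $A,B\in\mathrm{Fin}(S)$, $\exists A'(A\prec_U A'\vdash B)\iff\exists B'(A\vdash B'\prec_L B)$. Write $A\ll B$ if these equivalent conditions hold. **Isomorphism.** For $\mathcal U\in\mathrm{Fin}(\mathrm{Fin}(S))$ let $\mathcal U^*$ be the set of all unions $\bigcup_{A\in\mathcal U}C_A$ with each $C_A$ an inhabited finite subset of $A$. For relations $r\subseteq \mathrm{Fin}(S)\times\mathrm{Fin}(S')$ and $s\subseteq \mathrm{Fin}(S')\times\mathrm{Fin}(S'')$ let $A\,(s\cdot r)\,C$ mean that there is $\mathcal V\in\mathrm{Fin}(\mathrm{Fin}(S'))$ with $A\,r\,B'$ for all $B'\in\mathcal V^*$ and $B\,s\,C$ for all $B\in\mathcal V$, and let $\mathcal U\,\tilde r\,\mathcal V$ mean that $A\,r\,B$ for all $A\in\mathcal U$, $B\in\mathcal V^*$. A join-preserving proximity map from $(S,\vdash,\prec)$ to $(S',\vdash',\prec')$ is a relation $r\subseteq\mathrm{Fin}(S)\times\mathrm{Fin}(S')$ such that $A\,r\,B$ implies $(A\cup A')\,r\,(B\cup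 B')$; ${\ll'}\cdot r=r=r\cdot{\ll}$; and whenever $A\,r\,B$ there is $\mathcal U\in\mathrm{Fin}(\mathrm{Fin}(S))$ with $\{A\}\mathrel{\tilde\vdash}\mathcal U$ such that every $A'\in\mathcal U$ satisfies $A'\,r\,\{b\}$ for some $b\in B$. Strong continuous entailment relations and join-preserving proximity maps form a category, with composition $\cdot$ and identities $\ll$; $\cong$ denotes isomorphism in it. **Constructions.** For a strong continuous entailment relation $X=(S,\vdash,\prec)$ let $F(X)$ be the strong proximity lattice consisting of $\mathrm{Fin}(\mathrm{Fin}(S))$ preordered by $\tilde\vdash$ and divided by the induced equivalence, with $0=\emptyset$, $1=\{\emptyset\}$, $\mathcal U\vee\mathcal V=\mathcal U\cup\mathcal V$, $\mathcal U\wedge\mathcal V=\{A\cup B\mid A\in\mathcal U,B\in\mathcal V\}$, and with the relation induced by $\widetilde{\ll}$. For a strong proximity lattice $(S,\prec)$ let $$\Sigma(S)=(S,\vdash_\Sigma,\succ),\quad P_U(S)=(S,\vdash_U,\prec),\quad P_L(S)=(S,\vdash_L,\prec),\quad P_D(S)=(S,\vdash_D,\prec)$$ be the strong continuous entailment relations (presenting,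 respectively, the Scott topology of the locale of rounded ideals of $S$ and the upper, lower and double powerlocales of that locale) whose entailment relations are the smallest ones containing the axioms - $\vdash_\Sigma$: $\emptyset\vdash\{0\}$; $\{a,b\}\vdash \{a\vee b\}$; $\{a\}\vdash \{b\}$ if $b\le a$; - $\vdash_U$: $\emptyset\vdash \{1\}$; $\{a,b\}\vdash \{a\wedge b\}$; $\{a\}\vdash \{b\}$ if $a\le b$; - $\vdash_L$: $\{0\}\vdash\emptyset$; $\{a\vee b\}\vdash \{a,b\}$; $\{a\}\vdash \{b\}$ if $a\le b$; - $\vdash_D$: $\{a\}\vdash \{b\}$ if $a\le b$. In composites, $F$ is applied in between: for example $\Sigma(\Sigma(S))$ means $\Sigma(F(\Sigma(S)))$ and $P_U(P_L(S))$ means $P_U(F(P_L(S)))$. **Proposition.** For every strong proximity lattice $(S,\prec)$, $$P_D(S)\cong\Sigma(\Sigma(S)),\qquad P_D(S)\cong P_U(P_L(S)),\qquad P_U(P_L(S))\cong\Sigma(\Sigma(S)),\qquad P_U(\Sigma(S))\cong\Sigma(P_L(S)).$$ -/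

import Mathlib

universe u v w

namespace DeGroot

open scoped Classical

noncomputable section

/-! ## Strong proximity lattices -/

/-- A proximity relation between bounded distributive lattices: every set `{a | a r b}` is an
ideal and every set `{b | a r b}` is a filter. -/
structure IsProximityRel {S : Type u} {T : Type v} [DistribLattice S] [BoundedOrder S]
    [DistribLattice T] [BoundedOrder T] (r : S → T → Prop) : Prop where
  bot_left : ∀ b, r ⊥ b
  sup_left : ∀ {a a' b}, r a b → r a' b → r (a ⊔ a') b
  down_left : ∀ {a a' b}, a' ≤ a → r a b → r a' b
  top_right : ∀ a, r a ⊤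
  inf_right : ∀ {a b b'}, r a b → r a b' → r a (b ⊓ b')
  up_right : ∀ {a b b'}, r a b → b ≤ b' → r a b'

/-- Join-preservation of a proximity relation. -/
structure IsJoinPreservingRel {S : Type u} {T : Type v} [DistribLattice S] [BoundedOrder S]
    [DistribLattice T] [BoundedOrder T] (r : S → T → Prop) : Prop where
  prox_zero : ∀ {a}, r a ⊥ → a = ⊥
  prox_sup : ∀ {a b c}, r a (b ⊔ c) → ∃ b' c', a ≤ b' ⊔ c' ∧ r b' b ∧ r c' c

/-- A relation `r` on a type is idempotent: `r ∘ r = r`. -/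
def IsIdem {S : Type u} (r : S → S → Prop) : Prop :=
  ∀ a c, (∃ b, r a b ∧ r b c) ↔ r a c

/-- A strong proximity lattice `(S, ≺)`. -/
structure StrongProxLat where
  carrier : Type u
  [lat : DistribLattice carrier]
  [bdd : BoundedOrder carrier]
  prec : carrier → carrier → Prop
  isProx : IsProximityRel prec
  idem : IsIdem prec
  joinPres : IsJoinPreservingRel prec
  prox_one : ∀ {a}, prec ⊤ a → a = ⊤
  prox_inf : ∀ {a b c}, prec (b ⊓ c) a → ∃ b' c', prec b b' ∧ prec c c' ∧ b' ⊓ c' ≤ a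

attribute [instance] StrongProxLat.lat StrongProxLat.bdd

/-! ## Finite subsets and entailment relations -/

section Finite

variable {S : Type u} {T : Type v} {R : Type w}

/-- `𝒰*`: the finite sets obtained by choosing an inhabited subset of every `A ∈ 𝒰` and taking
the union of the chosen sets. Equivalently, the subsets of `⋃ 𝒰` that meet every member of `𝒰`.
The recursive description is given by `star_empty` and `star_insert` below. -/
def star (U : Finset (Finset S)) : Finset (Finset S) :=
  (U.biUnion id).powerset.filter fun D => ∀ A ∈ U, (D ∩ A).Nonempty

theorem mem_star {U : Finset (Finset S)} {D : Finset S} :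
    D ∈ star U ↔ D ⊆ U.biUnion id ∧ ∀ A ∈ U, (D ∩ A).Nonempty := by
  simp [star]

theorem star_empty : star (∅ : Finset (Finset S)) = {∅} := by
  ext D
  simp [mem_star]

theorem star_insert (U : Finset (Finset S)) (A D : Finset S) :
    D ∈ star (insert A U) ↔ ∃ B ∈ star U, ∃ C : Finset S, C ⊆ A ∧ C.Nonempty ∧ D = B ∪ C := by
  constructor
  · intro h
    rw [mem_star] at h
    refine ⟨D ∩ U.biUnion id, ?_, D ∩ A, Finset.inter_subset_right,
      h.2 A (Finset.mem_insert_self _ _), ?_⟩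
    · rw [mem_star]
      refine ⟨Finset.inter_subset_right, fun B hB => ?_⟩
      obtain ⟨x, hx⟩ := h.2 B (Finset.mem_insert_of_mem hB)
      rw [Finset.mem_inter] at hx
      refine ⟨x, ?_⟩
      simp only [Finset.mem_inter, Finset.mem_biUnion, id]
      exact ⟨⟨hx.1, B, hB, hx.2⟩, hx.2⟩
    · ext x
      have := @h.1 x
      simp only [Finset.mem_biUnion, Finset.mem_insert, id, Finset.mem_union,
        Finset.mem_inter] at this ⊢
      grind
  · rintro ⟨B, hB, C, hCA, hC, rfl⟩
    rw [mem_star] at hB ⊢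
    constructor
    · intro x hx
      have := @hB.1 x
      simp only [Finset.mem_biUnion, Finset.mem_insert, id, Finset.mem_union] at this hx ⊢
      rcases hx with hx | hx
      · obtain ⟨E, hE, hxE⟩ := this hx
        exact ⟨E, Or.inr hE, hxE⟩
      · exact ⟨A, Or.inl rfl, hCA hx⟩
    · intro E hE
      rcases Finset.mem_insert.1 hE with rfl | hE
      · obtain ⟨x, hx⟩ := hC
        exact ⟨x, by simp [hx, hCA hx]⟩
      · obtain ⟨x, hx⟩ := hB.2 E hE
        rw [Finset.mem_inter] at hx
        exact ⟨x, by simp [hx.1, hx.2]⟩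

/-- Upper relations between finite subsets. -/
def IsUpper (r : Finset S → Finset T → Prop) : Prop :=
  ∀ A A' B B', r A B → r (A ∪ A') (B ∪ B')

/-- The cut composition `s · r`. -/
def cutComp (s : Finset T → Finset R → Prop) (r : Finset S → Finset T → Prop) :
    Finset S → Finset R → Prop := fun A C =>
  ∃ V : Finset (Finset T), (∀ B' ∈ star V, r A B') ∧ ∀ B ∈ V, s B C

/-- The extension of a relation between finite subsets to one between finite sets of finite
subsets, `𝒰 r̃ 𝒱 ↔ ∀ A ∈ 𝒰, ∀ B ∈ 𝒱*, A r B`. -/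
def ext (r : Finset S → Finset T → Prop) (U : Finset (Finset S)) (V : Finset (Finset T)) : Prop :=
  ∀ A ∈ U, ∀ B ∈ star V, r A B

/-- `A ≺_L B`. -/
def lowerExt (p : S → S → Prop) (A B : Finset S) : Prop := ∀ a ∈ A, ∃ b ∈ B, p a b

/-- `A ≺_U B`. -/
def upperExt (p : S → S → Prop) (A B : Finset S) : Prop := ∀ b ∈ B, ∃ a ∈ A, p a b

/-- Entailment relations (reflexivity, monotonicity, cut). -/
structure IsEntailment (E : Finset S → Finset S → Prop) : Prop where
  refl : ∀ a, E {a} {a}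
  mono : ∀ {A B} (A' B'), E A B → E (A' ∪ A) (B ∪ B')
  cut : ∀ {A B a}, E A (B ∪ {a}) → E ({a} ∪ A) B → E A B

/-- The entailment relation generated by a set of axioms, i.e. the smallest entailment relation
that contains the axioms. -/
inductive GenEnt (ax : Finset S → Finset S → Prop) : Finset S → Finset S → Prop
  | ax {A B} : ax A B → GenEnt ax A B
  | refl (a) : GenEnt ax {a} {a}
  | mono {A B} (A' B') : GenEnt ax A B → GenEnt ax (A' ∪ A) (B ∪ B')
  | cut {A B a} : GenEnt ax A (B ∪ {a}) → GenEnt ax ({a} ∪ A) B → GenEnt ax A B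

theorem GenEnt.isEntailment (ax : Finset S → Finset S → Prop) : IsEntailment (GenEnt ax) :=
  ⟨.refl, .mono, .cut⟩

theorem GenEnt.smallest {ax E : Finset S → Finset S → Prop} (hE : IsEntailment E)
    (h : ∀ A B, ax A B → E A B) {A B : Finset S} (hAB : GenEnt ax A B) : E A B := by
  induction hAB with
  | ax h' => exact h _ _ h'
  | refl a => exact hE.refl a
  | mono A' B' _ ih => exact hE.mono A' B' ih
  | cut _ _ ih1 ih2 => exact hE.cut ih1 ih2

end Finite

/-- A strong continuous entailment relation `(S, ⊢, ≺)`. -/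
structure SContEnt where
  carrier : Type u
  ent : Finset carrier → Finset carrier → Prop
  prec : carrier → carrier → Prop
  isEnt : IsEntailment ent
  idem : IsIdem prec
  cont : ∀ A B, (∃ A', upperExt prec A A' ∧ ent A' B) ↔ (∃ B', ent A B' ∧ lowerExt prec B' B)

namespace SContEnt

/-- The relation `≪_⊢ = ⊢ ∘ ≺_U` of a strong continuous entailment relation. -/
def ll (X : SContEnt.{u}) (A B : Finset X.carrier) : Prop :=
  ∃ A', upperExt X.prec A A' ∧ X.ent A' B

/-- Proximity maps `r : X → Y`, i.e. Karoubi morphisms between the entailment systems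
`(X, ≪_⊢)` and `(Y, ≪_⊢')`. -/
structure IsProximityMap (X : SContEnt.{u}) (Y : SContEnt.{v})
    (r : Finset X.carrier → Finset Y.carrier → Prop) : Prop where
  upper : IsUpper r
  comp_left : cutComp Y.ll r = r
  comp_right : cutComp r X.ll = r

/-- Join-preservation of a proximity map. -/
def IsJoinPreserving (X : SContEnt.{u}) (Y : SContEnt.{v})
    (r : Finset X.carrier → Finset Y.carrier → Prop) : Prop :=
  ∀ A B, r A B → ∃ U : Finset (Finset X.carrier),
    ext X.ent {A} U ∧ ∀ A' ∈ U, ∃ b ∈ B, r A' {b}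

/-- Isomorphism in the category of strong continuous entailment relations and join-preserving
proximity maps, in which composition is the cut composition and the identity on `X` is `≪_⊢`. -/
def Isomorphic (X : SContEnt.{u}) (Y : SContEnt.{v}) : Prop :=
  ∃ (r : Finset X.carrier → Finset Y.carrier → Prop)
    (s : Finset Y.carrier → Finset X.carrier → Prop),
    (IsProximityMap X Y r ∧ IsJoinPreserving X Y r) ∧
    (IsProximityMap Y X s ∧ IsJoinPreserving Y X s) ∧
    cutComp s r = X.ll ∧ cutComp r s = Y.ll

end SContEnt

/-! ## Auxiliary facts on entailment relations -/

section Facts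

variable {S : Type u} {T : Type v}

/-- `D` meets every member of `V`. -/
def Meets (D : Finset S) (V : Finset (Finset S)) : Prop := ∀ B ∈ V, ∃ x ∈ B, x ∈ D

theorem Meets.of_star {D : Finset S} {V : Finset (Finset S)} (h : D ∈ star V) : Meets D V := by
  intro B hB
  obtain ⟨x, hx⟩ := (mem_star.1 h).2 B hB
  rw [Finset.mem_inter] at hx
  exact ⟨x, hx.2, hx.1⟩

theorem Meets.exists_star {D : Finset S} {V : Finset (Finset S)} (h : Meets D V) :
    ∃ E ∈ star V, E ⊆ D := by
  refine ⟨D ∩ V.biUnion id, mem_star.2 ⟨Finset.inter_subset_right, fun B hB => ?_⟩,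
    Finset.inter_subset_left⟩
  obtain ⟨x, hx, hxD⟩ := h B hB
  refine ⟨x, ?_⟩
  simp only [Finset.mem_inter, Finset.mem_biUnion, id]
  exact ⟨⟨hxD, B, hB, hx⟩, hx⟩

theorem Meets.star_star {E : Finset S} {V : Finset (Finset S)} (h : Meets E (star V)) :
    ∃ D ∈ V, D ⊆ E := by
  by_contra! hn
  have hm : Meets ((V.biUnion id).filter fun x => x ∉ E) V := by
    intro D hD
    obtain ⟨x, hx, hxE⟩ := Finset.not_subset.1 (hn D hD)
    refine ⟨x, hx, ?_⟩
    simp only [Finset.mem_filter, Finset.mem_biUnion, id]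
    exact ⟨⟨D, hD, hx⟩, hxE⟩
  obtain ⟨F, hF, hFs⟩ := hm.exists_star
  obtain ⟨x, hxF, hxE⟩ := h F hF
  exact (Finset.mem_filter.1 (hFs hxF)).2 hxE

theorem IsUpper.sub {r : Finset S → Finset T → Prop} (hr : IsUpper r) {A A' : Finset S}
    {B B' : Finset T} (h : r A B) (hA : A ⊆ A') (hB : B ⊆ B') : r A' B' := by
  have := hr A A' B B' h
  rwa [Finset.union_eq_right.2 hA, Finset.union_eq_right.2 hB] at this

theorem ext_iff {r : Finset S → Finset T → Prop} (hr : IsUpper r) {U : Finset (Finset S)}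
    {V : Finset (Finset T)} : ext r U V ↔ ∀ A ∈ U, ∀ D, Meets D V → r A D := by
  constructor
  · intro h A hA D hD
    obtain ⟨E, hE, hED⟩ := hD.exists_star
    exact hr.sub (h A hA E hE) subset_rfl hED
  · intro h A hA D hD
    exact h A hA D (Meets.of_star hD)

variable {E : Finset S → Finset S → Prop}

theorem IsEntailment.isUpper (hE : IsEntailment E) : IsUpper E := by
  intro A A' B B' h
  rw [Finset.union_comm A A']
  exact hE.mono A' B' h

theorem IsEntailment.of_mem (hE : IsEntailment E) {A B : Finset S} {x : S} (hA : x ∈ A)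
    (hB : x ∈ B) : E A B :=
  hE.isUpper.sub (hE.refl x) (by simpa using hA) (by simpa using hB)

theorem IsEntailment.multicut (hE : IsEntailment E) {A X : Finset S} (C : Finset S)
    (h : ∀ c ∈ C, E A (X ∪ {c})) (h' : E (C ∪ A) X) : E A X := by
  induction C using Finset.induction_on with
  | empty => simpa using h'
  | insert c C _ ih =>
    refine ih (fun d hd => h d (Finset.mem_insert_of_mem hd)) ?_
    refine hE.cut (a := c) (hE.isUpper.sub (h c (Finset.mem_insert_self _ _))
      Finset.subset_union_right subset_rfl) ?_
    convert h' using 1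
    ext x
    simp

theorem IsEntailment.bigcut (hE : IsEntailment E) {A D : Finset S} (V : Finset (Finset S))
    (h : ∀ F, Meets F V → E A (F ∪ D)) (h' : ∀ B ∈ V, E (B ∪ A) D) : E A D := by
  induction V using Finset.induction_on with
  | empty => simpa using h ∅ (by simp [Meets])
  | insert C W _ ih =>
    refine ih (fun F hF => ?_) (fun B hB => h' B (Finset.mem_insert_of_mem hB))
    refine hE.multicut C (fun c hc => ?_) (hE.isUpper.sub (h' C (Finset.mem_insert_self _ _))
      subset_rfl Finset.subset_union_right)
    refine hE.isUpper.sub (h (F ∪ {c}) ?_) subset_rfl ?_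
    · intro B hB
      rcases Finset.mem_insert.1 hB with rfl | hB
      · exact ⟨c, hc, by simp⟩
      · obtain ⟨x, hx, hxF⟩ := hF B hB
        exact ⟨x, hx, by simp [hxF]⟩
    · intro x
      simp only [Finset.mem_union]
      tauto

/-- Cutting along the normal form `V`. -/
theorem IsEntailment.trans (hE : IsEntailment E) {A D : Finset S} (V : Finset (Finset S))
    (h : ∀ F, Meets F V → E A F) (h' : ∀ B ∈ V, E B D) : E A D :=
  hE.bigcut V (fun F hF => hE.isUpper.sub (h F hF) subset_rfl Finset.subset_union_left)
    (fun B hB => hE.isUpper.sub (h' B hB) Finset.subset_union_left subset_rfl)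

theorem IsEntailment.ext_refl (hE : IsEntailment E) (U : Finset (Finset S)) : ext E U U := by
  rw [ext_iff hE.isUpper]
  intro A hA D hD
  obtain ⟨x, hx, hxD⟩ := hD A hA
  exact hE.of_mem hx hxD

theorem IsEntailment.ext_trans (hE : IsEntailment E) {U V W : Finset (Finset S)}
    (h : ext E U V) (h' : ext E V W) : ext E U W := by
  rw [ext_iff hE.isUpper] at *
  intro A hA D hD
  exact hE.trans V (h A hA) (fun B hB => h' B hB D hD)

end Facts

/-! ## The strong proximity lattice of a strong continuous entailment relation -/

namespace SContEnt

variable (X : SContEnt.{u})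

/-- The setoid `=_⊢` on finite sets of finite subsets. -/
def entSetoid : Setoid (Finset (Finset X.carrier)) where
  r U V := ext X.ent U V ∧ ext X.ent V U
  iseqv :=
    ⟨fun U => ⟨X.isEnt.ext_refl U, X.isEnt.ext_refl U⟩, fun h => ⟨h.2, h.1⟩,
      fun h h' => ⟨X.isEnt.ext_trans h.1 h'.1, X.isEnt.ext_trans h'.2 h.2⟩⟩

/-- The underlying set of the distributive lattice determined by `(S, ⊢)`. -/
def EntLat : Type u := Quotient X.entSetoid

/-- Representatives of the meet of two elements. -/
def meetRep (U V : Finset (Finset X.carrier)) : Finset (Finset X.carrier) :=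
  Finset.image₂ (fun A B => A ∪ B) U V

variable {X}

theorem ext_def {U V : Finset (Finset X.carrier)} :
    ext X.ent U V ↔ ∀ A ∈ U, ∀ D, Meets D V → X.ent A D :=
  ext_iff X.isEnt.isUpper

theorem ext_union_left {U V W : Finset (Finset X.carrier)} :
    ext X.ent (U ∪ V) W ↔ ext X.ent U W ∧ ext X.ent V W := by
  simp only [ext, Finset.mem_union]
  grind

theorem ext_of_subset {U V : Finset (Finset X.carrier)} (h : U ⊆ V) : ext X.ent U V := by
  rw [ext_def]
  intro A hA D hD
  obtain ⟨x, hx, hxD⟩ := hD A (h hA)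
  exact X.isEnt.of_mem hx hxD

theorem meets_meetRep {D : Finset X.carrier} {U V : Finset (Finset X.carrier)} :
    Meets D (X.meetRep U V) ↔ Meets D U ∨ Meets D V := by
  constructor
  · intro h
    by_contra! hn
    simp only [Meets] at hn
    push Not at hn
    obtain ⟨⟨B, hB, hB'⟩, C, hC, hC'⟩ := hn
    obtain ⟨x, hx, hxD⟩ := h (B ∪ C) (Finset.mem_image₂_of_mem hB hC)
    rcases Finset.mem_union.1 hx with hx | hx
    · exact hB' x hx hxD
    · exact hC' x hx hxD
  · rintro (h | h) E hE
    · obtain ⟨B, hB, C, hC, rfl⟩ := Finset.mem_image₂.1 hE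
      obtain ⟨x, hx, hxD⟩ := h B hB
      exact ⟨x, by simp [hx], hxD⟩
    · obtain ⟨B, hB, C, hC, rfl⟩ := Finset.mem_image₂.1 hE
      obtain ⟨x, hx, hxD⟩ := h C hC
      exact ⟨x, by simp [hx], hxD⟩

theorem ext_meetRep_right {U V W : Finset (Finset X.carrier)} :
    ext X.ent W (X.meetRep U V) ↔ ext X.ent W U ∧ ext X.ent W V := by
  simp only [ext_def, meets_meetRep]
  grind

theorem meetRep_ext_left (U V : Finset (Finset X.carrier)) : ext X.ent (X.meetRep U V) U := by
  rw [ext_def]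
  intro A hA D hD
  obtain ⟨B, hB, C, hC, rfl⟩ := Finset.mem_image₂.1 hA
  obtain ⟨x, hx, hxD⟩ := hD B hB
  exact X.isEnt.of_mem (by simp [hx]) hxD

theorem meetRep_ext_right (U V : Finset (Finset X.carrier)) : ext X.ent (X.meetRep U V) V := by
  rw [ext_def]
  intro A hA D hD
  obtain ⟨B, hB, C, hC, rfl⟩ := Finset.mem_image₂.1 hA
  obtain ⟨x, hx, hxD⟩ := hD C hC
  exact X.isEnt.of_mem (by simp [hx]) hxD

theorem union_ext {U V W : Finset (Finset X.carrier)} (h : ext X.ent U W) (h' : ext X.ent V W) :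
    ext X.ent (U ∪ V) W := ext_union_left.2 ⟨h, h'⟩

theorem union_mono {U U' V V' : Finset (Finset X.carrier)} (h : ext X.ent U U')
    (h' : ext X.ent V V') : ext X.ent (U ∪ V) (U' ∪ V') :=
  union_ext (X.isEnt.ext_trans h (ext_of_subset Finset.subset_union_left))
    (X.isEnt.ext_trans h' (ext_of_subset Finset.subset_union_right))

theorem meetRep_mono {U U' V V' : Finset (Finset X.carrier)} (h : ext X.ent U U')
    (h' : ext X.ent V V') : ext X.ent (X.meetRep U V) (X.meetRep U' V') :=
  ext_meetRep_right.2 ⟨X.isEnt.ext_trans (meetRep_ext_left U V) h,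
    X.isEnt.ext_trans (meetRep_ext_right U V) h'⟩

/-- The class of `𝒰`. -/
def EntLat.mk (U : Finset (Finset X.carrier)) : X.EntLat := Quotient.mk X.entSetoid U

instance : LE X.EntLat where
  le := Quotient.lift₂ (ext X.ent) (by
    intro U V U' V' h h'
    exact propext ⟨fun k => X.isEnt.ext_trans h.2 (X.isEnt.ext_trans k h'.1),
      fun k => X.isEnt.ext_trans h.1 (X.isEnt.ext_trans k h'.2)⟩)

instance : Max X.EntLat where
  max := Quotient.map₂ (fun U V => U ∪ V) (by
    intro U U' h V V' h'
    exact ⟨union_mono h.1 h'.1, union_mono h.2 h'.2⟩)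

instance : Min X.EntLat where
  min := Quotient.map₂ X.meetRep (by
    intro U U' h V V' h'
    exact ⟨meetRep_mono h.1 h'.1, meetRep_mono h.2 h'.2⟩)

theorem EntLat.mk_le {U V : Finset (Finset X.carrier)} :
    EntLat.mk U ≤ EntLat.mk V ↔ ext X.ent U V := Iff.rfl

theorem EntLat.mk_sup (U V : Finset (Finset X.carrier)) :
    EntLat.mk U ⊔ EntLat.mk V = EntLat.mk (U ∪ V) := rfl

theorem EntLat.mk_inf (U V : Finset (Finset X.carrier)) :
    EntLat.mk U ⊓ EntLat.mk V = EntLat.mk (X.meetRep U V) := rfl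

theorem EntLat.ind {P : X.EntLat → Prop} (h : ∀ U, P (EntLat.mk U)) (x : X.EntLat) : P x :=
  Quotient.ind h x

instance : PartialOrder X.EntLat where
  le_refl := EntLat.ind fun U => X.isEnt.ext_refl U
  le_trans := EntLat.ind fun U => EntLat.ind fun V => EntLat.ind fun W => by
    intro h h'
    exact X.isEnt.ext_trans h h'
  le_antisymm := EntLat.ind fun U => EntLat.ind fun V => by
    intro h h'
    exact Quotient.sound ⟨h, h'⟩

instance : Lattice X.EntLat where
  sup := max
  inf := min
  le_sup_left := EntLat.ind fun U => EntLat.ind fun V =>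
    ext_of_subset (X := X) Finset.subset_union_left
  le_sup_right := EntLat.ind fun U => EntLat.ind fun V =>
    ext_of_subset (X := X) Finset.subset_union_right
  sup_le := EntLat.ind fun U => EntLat.ind fun V => EntLat.ind fun W => by
    intro h h'
    exact union_ext h h'
  inf_le_left := EntLat.ind fun U => EntLat.ind fun V => meetRep_ext_left U V
  inf_le_right := EntLat.ind fun U => EntLat.ind fun V => meetRep_ext_right U V
  le_inf := EntLat.ind fun U => EntLat.ind fun V => EntLat.ind fun W => by
    intro h h'
    exact ext_meetRep_right.2 ⟨h, h'⟩

instance : DistribLattice X.EntLat where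
  le_sup_inf := EntLat.ind fun U => EntLat.ind fun V => EntLat.ind fun W => by
    change ext X.ent (X.meetRep (U ∪ V) (U ∪ W)) (U ∪ X.meetRep V W)
    rw [ext_def]
    intro A hA D hD
    obtain ⟨B, hB, C, hC, rfl⟩ := Finset.mem_image₂.1 hA
    by_cases hBU : B ∈ U
    · obtain ⟨x, hx, hxD⟩ := hD B (by simp [hBU])
      exact X.isEnt.of_mem (by simp [hx]) hxD
    by_cases hCU : C ∈ U
    · obtain ⟨x, hx, hxD⟩ := hD C (by simp [hCU])
      exact X.isEnt.of_mem (by simp [hx]) hxD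
    obtain ⟨x, hx, hxD⟩ := hD (B ∪ C) (Finset.mem_union_right _
      (Finset.mem_image₂_of_mem ((Finset.mem_union.1 hB).resolve_left hBU)
        ((Finset.mem_union.1 hC).resolve_left hCU)))
    exact X.isEnt.of_mem hx hxD

instance : BoundedOrder X.EntLat where
  bot := EntLat.mk ∅
  top := EntLat.mk {∅}
  bot_le := EntLat.ind fun U => by
    change ext X.ent ∅ U
    simp [ext]
  le_top := EntLat.ind fun U => by
    change ext X.ent U {∅}
    rw [ext_def]
    intro A _ D hD
    obtain ⟨x, hx, -⟩ := hD ∅ (by simp)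
    simp at hx

/-! ### The relation on the lattice -/

theorem lowerExt_trans {A B C : Finset X.carrier} (h : lowerExt X.prec A B)
    (h' : lowerExt X.prec B C) : lowerExt X.prec A C := by
  intro a ha
  obtain ⟨b, hb, hab⟩ := h a ha
  obtain ⟨c, hc, hbc⟩ := h' b hb
  exact ⟨c, hc, (X.idem a c).1 ⟨b, hab, hbc⟩⟩

theorem lowerExt_interp {A C : Finset X.carrier} (h : lowerExt X.prec A C) :
    ∃ B, lowerExt X.prec A B ∧ lowerExt X.prec B C := by
  have : ∀ a ∈ A, ∃ b, X.prec a b ∧ ∃ c ∈ C, X.prec b c := by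
    intro a ha
    obtain ⟨c, hc, hac⟩ := h a ha
    obtain ⟨b, hab, hbc⟩ := (X.idem a c).2 hac
    exact ⟨b, hab, c, hc, hbc⟩
  choose! f hf hf' using this
  refine ⟨A.image f, fun a ha => ⟨f a, Finset.mem_image_of_mem f ha, hf a ha⟩, fun b hb => ?_⟩
  obtain ⟨a, ha, rfl⟩ := Finset.mem_image.1 hb
  exact hf' a ha

theorem lowerExt_biUnion {ι : Type*} {s : Finset ι} {f : ι → Finset X.carrier}
    {B : Finset X.carrier} (h : ∀ i ∈ s, lowerExt X.prec (f i) B) :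
    lowerExt X.prec (s.biUnion f) B := by
  intro a ha
  obtain ⟨i, hi, hai⟩ := Finset.mem_biUnion.1 ha
  exact h i hi a hai

theorem upperExt_biUnion {ι : Type*} {s : Finset ι} {f : ι → Finset X.carrier}
    {A : Finset X.carrier} (h : ∀ i ∈ s, upperExt X.prec A (f i)) :
    upperExt X.prec A (s.biUnion f) := by
  intro a ha
  obtain ⟨i, hi, hai⟩ := Finset.mem_biUnion.1 ha
  exact h i hi a hai

theorem ll_iff {A B : Finset X.carrier} :
    X.ll A B ↔ ∃ B', X.ent A B' ∧ lowerExt X.prec B' B := X.cont A B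

theorem ll_isUpper : IsUpper X.ll := by
  rintro A A' B B' ⟨C, hC, hCB⟩
  refine ⟨C, fun c hc => ?_, X.isEnt.isUpper.sub hCB subset_rfl Finset.subset_union_left⟩
  obtain ⟨a, ha, hac⟩ := hC c hc
  exact ⟨a, by simp [ha], hac⟩

theorem ll_of_prec {A B : Finset X.carrier} {a b : X.carrier} (ha : a ∈ A) (hb : b ∈ B)
    (h : X.prec a b) : X.ll A B :=
  ⟨{b}, fun c hc => ⟨a, ha, by rw [Finset.mem_singleton.1 hc]; exact h⟩,
    X.isEnt.of_mem (x := b) (by simp) hb⟩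

/-- `U ≤ V ≪ B` gives `U ≪ B`. -/
theorem ent_ll_trans {A D : Finset X.carrier} (V : Finset (Finset X.carrier))
    (h : ∀ F, Meets F V → X.ent A F) (h' : ∀ B ∈ V, X.ll B D) : X.ll A D := by
  simp only [ll_iff] at h' ⊢
  choose! f hf hf' using h'
  exact ⟨V.biUnion f, X.isEnt.trans V h fun B hB =>
    X.isEnt.isUpper.sub (hf B hB) subset_rfl (Finset.subset_biUnion_of_mem f hB),
    lowerExt_biUnion hf'⟩

theorem ll_ent_trans {A D : Finset X.carrier} (V : Finset (Finset X.carrier))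
    (h : ∀ F, Meets F V → X.ll A F) (h' : ∀ B ∈ V, X.ent B D) : X.ll A D := by
  have h1 : ∀ F ∈ star V, X.ll A F := fun F hF => h F (Meets.of_star hF)
  choose! f hf hf' using h1
  refine ⟨(star V).biUnion f, upperExt_biUnion hf, X.isEnt.trans V (fun F hF => ?_) h'⟩
  obtain ⟨G, hG, hGF⟩ := hF.exists_star
  exact X.isEnt.isUpper.sub (hf' G hG) (Finset.subset_biUnion_of_mem f hG) hGF

theorem ll_lowerExt {A B C : Finset X.carrier} (h : X.ll A B) (h' : lowerExt X.prec B C) :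
    X.ll A C := by
  rw [ll_iff] at h ⊢
  obtain ⟨D, hD, hDB⟩ := h
  exact ⟨D, hD, lowerExt_trans hDB h'⟩

theorem ext_ll_def {U V : Finset (Finset X.carrier)} :
    ext X.ll U V ↔ ∀ A ∈ U, ∀ D, Meets D V → X.ll A D :=
  ext_iff ll_isUpper

theorem ext_ent_ll {U V W : Finset (Finset X.carrier)} (h : ext X.ent U V) (h' : ext X.ll V W) :
    ext X.ll U W := by
  rw [ext_def] at h
  rw [ext_ll_def] at *
  exact fun A hA D hD => ent_ll_trans V (h A hA) fun B hB => h' B hB D hD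

theorem ext_ll_ent {U V W : Finset (Finset X.carrier)} (h : ext X.ll U V) (h' : ext X.ent V W) :
    ext X.ll U W := by
  rw [ext_def] at h'
  rw [ext_ll_def] at *
  exact fun A hA D hD => ll_ent_trans V (h A hA) fun B hB => h' B hB D hD

theorem ext_ll_trans {U V W : Finset (Finset X.carrier)} (h : ext X.ll U V)
    (h' : ext X.ll V W) : ext X.ll U W := by
  rw [ext_ll_def] at *
  intro A hA D hD
  have h1 : ∀ B ∈ V, ∃ B', X.ent B B' ∧ lowerExt X.prec B' D :=
    fun B hB => ll_iff.1 (h' B hB D hD)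
  choose! f hf hf' using h1
  exact ll_lowerExt (ll_ent_trans V (h A hA) fun B hB =>
    X.isEnt.isUpper.sub (hf B hB) subset_rfl (Finset.subset_biUnion_of_mem f hB))
    (lowerExt_biUnion hf')

/-- If each `f D` lies below `D` for `D ∈ V*`, then `(f V*)* ≪ V`. -/
theorem star_image_ll {V : Finset (Finset X.carrier)} {f : Finset X.carrier → Finset X.carrier}
    (hf : ∀ D ∈ star V, lowerExt X.prec (f D) D) : ext X.ll (star ((star V).image f)) V := by
  intro B hB D hD
  obtain ⟨x, hx, hxB⟩ := Meets.of_star hB (f D) (Finset.mem_image_of_mem f hD)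
  obtain ⟨d, hd, hxd⟩ := hf D hD x hx
  exact ll_of_prec hxB hd hxd

theorem ext_ll_interp {U W : Finset (Finset X.carrier)} (h : ext X.ll U W) :
    ∃ V, ext X.ll U V ∧ ext X.ll V W := by
  have h1 : ∀ D ∈ star W, ∃ D'', (∀ A ∈ U, X.ll A D'') ∧ lowerExt X.prec D'' D := by
    intro D hD
    have h2 : ∀ A ∈ U, ∃ D', X.ent A D' ∧ lowerExt X.prec D' D := fun A hA => ll_iff.1 (h A hA D hD)
    choose! g hg hg' using h2
    obtain ⟨D'', hD1, hD2⟩ := lowerExt_interp (lowerExt_biUnion hg')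
    exact ⟨D'', fun A hA => ll_iff.2 ⟨_, X.isEnt.isUpper.sub (hg A hA) subset_rfl
      (Finset.subset_biUnion_of_mem g hA), hD1⟩, hD2⟩
  choose! f hf hf' using h1
  refine ⟨star ((star W).image f), ?_, star_image_ll hf'⟩
  intro A hA E hE
  obtain ⟨D, hD, hDE⟩ := (Meets.of_star hE).star_star
  obtain ⟨D, hD', rfl⟩ := Finset.mem_image.1 hD
  exact ll_isUpper.sub (hf D hD' A hA) subset_rfl hDE

theorem lowerExt_split {A B C : Finset X.carrier} (h : lowerExt X.prec A (B ∪ C)) :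
    ∃ B' C', A ⊆ B' ∪ C' ∧ lowerExt X.prec B' B ∧ lowerExt X.prec C' C := by
  refine ⟨A.filter fun a => ∃ b ∈ B, X.prec a b, A.filter fun a => ∃ b ∈ C, X.prec a b, ?_,
    fun a ha => (Finset.mem_filter.1 ha).2, fun a ha => (Finset.mem_filter.1 ha).2⟩
  intro a ha
  obtain ⟨x, hx, hax⟩ := h a ha
  simp only [Finset.mem_union, Finset.mem_filter] at hx ⊢
  grind

theorem upperExt_split {A B C : Finset X.carrier} (h : upperExt X.prec (B ∪ C) A) :
    ∃ B' C', A ⊆ B' ∪ C' ∧ upperExt X.prec B B' ∧ upperExt X.prec C C' := by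
  refine ⟨A.filter fun a => ∃ b ∈ B, X.prec b a, A.filter fun a => ∃ b ∈ C, X.prec b a, ?_,
    fun a ha => (Finset.mem_filter.1 ha).2, fun a ha => (Finset.mem_filter.1 ha).2⟩
  intro a ha
  obtain ⟨x, hx, hax⟩ := h a ha
  simp only [Finset.mem_union, Finset.mem_filter] at hx ⊢
  grind

theorem ext_ll_sup {U V W : Finset (Finset X.carrier)} (h : ext X.ll U (V ∪ W)) :
    ∃ V' W', ext X.ent U (V' ∪ W') ∧ ext X.ll V' V ∧ ext X.ll W' W := by
  rw [ext_ll_def] at h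
  have h1 : ∀ A ∈ U, ∀ B ∈ star V, ∀ C ∈ star W, ∃ B' C', X.ent A (B' ∪ C') ∧
      lowerExt X.prec B' B ∧ lowerExt X.prec C' C := by
    intro A hA B hB C hC
    have hm : Meets (B ∪ C) (V ∪ W) := by
      intro E hE
      rcases Finset.mem_union.1 hE with hE | hE
      · obtain ⟨x, hx, hx'⟩ := Meets.of_star hB E hE
        exact ⟨x, hx, by simp [hx']⟩
      · obtain ⟨x, hx, hx'⟩ := Meets.of_star hC E hE
        exact ⟨x, hx, by simp [hx']⟩
    obtain ⟨E, hE, hE'⟩ := ll_iff.1 (h A hA _ hm)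
    obtain ⟨B', C', hs, hB', hC'⟩ := lowerExt_split hE'
    exact ⟨B', C', X.isEnt.isUpper.sub hE subset_rfl hs, hB', hC'⟩
  choose! f g hfg hf hg using h1
  let f' : Finset X.carrier → Finset X.carrier := fun B =>
    U.biUnion fun A => (star W).biUnion fun C => f A B C
  let g' : Finset X.carrier → Finset X.carrier := fun C =>
    U.biUnion fun A => (star V).biUnion fun B => g A B C
  refine ⟨star ((star V).image f'), star ((star W).image g'), ?_,
    star_image_ll fun B hB => lowerExt_biUnion fun A hA => lowerExt_biUnion fun C hC =>
      hf A hA B hB C hC,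
    star_image_ll fun C hC => lowerExt_biUnion fun A hA => lowerExt_biUnion fun B hB =>
      hg A hA B hB C hC⟩
  rw [ext_def]
  intro A hA E hE
  have hE1 : Meets E (star ((star V).image f')) := fun B hB => hE B (Finset.mem_union_left _ hB)
  have hE2 : Meets E (star ((star W).image g')) := fun B hB => hE B (Finset.mem_union_right _ hB)
  obtain ⟨D, hD, hDE⟩ := hE1.star_star
  obtain ⟨B, hB, rfl⟩ := Finset.mem_image.1 hD
  obtain ⟨D, hD, hDE'⟩ := hE2.star_star
  obtain ⟨C, hC, rfl⟩ := Finset.mem_image.1 hD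
  refine X.isEnt.isUpper.sub (hfg A hA B hB C hC) subset_rfl (Finset.union_subset ?_ ?_)
  · refine subset_trans (fun x hx => ?_) hDE
    exact Finset.mem_biUnion.2 ⟨A, hA, Finset.mem_biUnion.2 ⟨C, hC, hx⟩⟩
  · refine subset_trans (fun x hx => ?_) hDE'
    exact Finset.mem_biUnion.2 ⟨A, hA, Finset.mem_biUnion.2 ⟨B, hB, hx⟩⟩

theorem image_ll {V : Finset (Finset X.carrier)} {f : Finset X.carrier → Finset X.carrier}
    (hf : ∀ D ∈ V, upperExt X.prec D (f D)) : ext X.ll V (V.image f) := by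
  intro B hB D hD
  obtain ⟨x, hx, hxD⟩ := Meets.of_star hD (f B) (Finset.mem_image_of_mem f hB)
  obtain ⟨b, hb, hbx⟩ := hf B hB x hx
  exact ll_of_prec hb hxD hbx

theorem ext_ll_inf {U V W : Finset (Finset X.carrier)} (h : ext X.ll (X.meetRep V W) U) :
    ∃ V' W', ext X.ll V V' ∧ ext X.ll W W' ∧ ext X.ent (X.meetRep V' W') U := by
  have h1 : ∀ B ∈ V, ∀ C ∈ W, ∀ D ∈ star U, ∃ B' C', X.ent (B' ∪ C') D ∧
      upperExt X.prec B B' ∧ upperExt X.prec C C' := by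
    intro B hB C hC D hD
    obtain ⟨E, hE, hE'⟩ := h (B ∪ C) (Finset.mem_image₂_of_mem hB hC) D hD
    obtain ⟨B', C', hs, hB', hC'⟩ := upperExt_split hE
    exact ⟨B', C', X.isEnt.isUpper.sub hE' hs subset_rfl, hB', hC'⟩
  choose! f g hfg hf hg using h1
  let f' : Finset X.carrier → Finset X.carrier := fun B =>
    W.biUnion fun C => (star U).biUnion fun D => f B C D
  let g' : Finset X.carrier → Finset X.carrier := fun C =>
    V.biUnion fun B => (star U).biUnion fun D => g B C D
  refine ⟨V.image f', W.image g',
    image_ll fun B hB => upperExt_biUnion fun C hC => upperExt_biUnion fun D hD =>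
      hf B hB C hC D hD,
    image_ll fun C hC => upperExt_biUnion fun B hB => upperExt_biUnion fun D hD =>
      hg B hB C hC D hD, ?_⟩
  intro A hA D hD
  obtain ⟨B1, hB1, C1, hC1, rfl⟩ := Finset.mem_image₂.1 hA
  obtain ⟨B, hB, rfl⟩ := Finset.mem_image.1 hB1
  obtain ⟨C, hC, rfl⟩ := Finset.mem_image.1 hC1
  refine X.isEnt.isUpper.sub (hfg B hB C hC D hD) (Finset.union_subset_union ?_ ?_) subset_rfl
  · exact fun x hx => Finset.mem_biUnion.2 ⟨C, hC, Finset.mem_biUnion.2 ⟨D, hD, hx⟩⟩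
  · exact fun x hx => Finset.mem_biUnion.2 ⟨B, hB, Finset.mem_biUnion.2 ⟨D, hD, hx⟩⟩

/-- The relation on the lattice induced by the extension of `≪_⊢`. -/
def EntLat.prec : X.EntLat → X.EntLat → Prop :=
  Quotient.lift₂ (ext X.ll) (by
    intro U V U' V' h h'
    exact propext ⟨fun k => ext_ent_ll h.2 (ext_ll_ent k h'.1),
      fun k => ext_ent_ll h.1 (ext_ll_ent k h'.2)⟩)

theorem EntLat.prec_mk {U V : Finset (Finset X.carrier)} :
    EntLat.prec (EntLat.mk U) (EntLat.mk V) ↔ ext X.ll U V := Iff.rfl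

variable (X)

/-- The functor `F` on objects: the strong proximity lattice of a strong continuous entailment
relation, with underlying lattice the finite sets of finite subsets modulo `=_⊢` and with the
relation induced by `≪_⊢`. -/
abbrev toProxLat : StrongProxLat.{u} where
  carrier := X.EntLat
  prec := EntLat.prec
  isProx :=
    { bot_left := EntLat.ind fun U => by
        change ext X.ll ∅ U
        simp [ext]
      sup_left := by
        intro a a' b
        induction a using EntLat.ind with | _ U
        induction a' using EntLat.ind with | _ V
        induction b using EntLat.ind with | _ W
        intro (h : ext X.ll U W) (h' : ext X.ll V W)
        change ext X.ll (U ∪ V) W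
        intro A hA
        exact (Finset.mem_union.1 hA).elim (h A) (h' A)
      down_left := by
        intro a a' b
        induction a using EntLat.ind with | _ U
        induction a' using EntLat.ind with | _ V
        induction b using EntLat.ind with | _ W
        exact ext_ent_ll
      top_right := EntLat.ind fun U => by
        change ext X.ll U {∅}
        rw [ext_ll_def]
        intro A _ D hD
        obtain ⟨x, hx, -⟩ := hD ∅ (by simp)
        simp at hx
      inf_right := by
        intro a b b'
        induction a using EntLat.ind with | _ U
        induction b using EntLat.ind with | _ V
        induction b' using EntLat.ind with | _ W
        intro (h : ext X.ll U V) (h' : ext X.ll U W)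
        change ext X.ll U (X.meetRep V W)
        rw [ext_ll_def] at *
        intro A hA D hD
        exact (meets_meetRep.1 hD).elim (h A hA D) (h' A hA D)
      up_right := by
        intro a b b'
        induction a using EntLat.ind with | _ U
        induction b using EntLat.ind with | _ V
        induction b' using EntLat.ind with | _ W
        exact ext_ll_ent }
  idem := EntLat.ind fun U => EntLat.ind fun W => by
    constructor
    · rintro ⟨b, hb⟩
      induction b using EntLat.ind with | _ V
      exact ext_ll_trans hb.1 hb.2
    · intro h
      obtain ⟨V, h1, h2⟩ := ext_ll_interp h
      exact ⟨EntLat.mk V, h1, h2⟩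
  joinPres :=
    { prox_zero := by
        intro a
        induction a using EntLat.ind with | _ U
        intro (h : ext X.ll U ∅)
        refine le_antisymm ?_ bot_le
        change ext X.ent U ∅
        rw [ext_ll_def] at h
        rw [ext_def]
        intro A hA D _
        obtain ⟨B, hB, hB'⟩ := ll_iff.1 (h A hA ∅ (by simp [Meets]))
        have : B = ∅ := by
          by_contra hne
          obtain ⟨x, hx⟩ := Finset.nonempty_iff_ne_empty.2 hne
          obtain ⟨b, hb, -⟩ := hB' x hx
          simp at hb
        subst this
        exact X.isEnt.isUpper.sub hB subset_rfl (Finset.empty_subset _)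
      prox_sup := by
        intro a b c
        induction a using EntLat.ind with | _ U
        induction b using EntLat.ind with | _ V
        induction c using EntLat.ind with | _ W
        intro h
        obtain ⟨V', W', h1, h2, h3⟩ := ext_ll_sup h
        exact ⟨EntLat.mk V', EntLat.mk W', h1, h2, h3⟩ }
  prox_one := by
    intro a
    induction a using EntLat.ind with | _ U
    intro (h : ext X.ll {∅} U)
    refine le_antisymm le_top ?_
    change ext X.ent {∅} U
    intro A hA D hD
    obtain rfl := Finset.mem_singleton.1 hA
    obtain ⟨B, hB, hB'⟩ := h ∅ hA D hD
    have : B = ∅ := by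
      by_contra hne
      obtain ⟨x, hx⟩ := Finset.nonempty_iff_ne_empty.2 hne
      obtain ⟨b, hb, -⟩ := hB x hx
      simp at hb
    subst this
    exact hB'
  prox_inf := by
    intro a b c
    induction a using EntLat.ind with | _ U
    induction b using EntLat.ind with | _ V
    induction c using EntLat.ind with | _ W
    intro h
    obtain ⟨V', W', h1, h2, h3⟩ := ext_ll_inf h
    exact ⟨EntLat.mk V', EntLat.mk W', h1, h2, h3⟩

end SContEnt

/-! ## The constructions `Σ`, `P_U`, `P_L`, `P_D` -/

namespace StrongProxLat

variable (S : StrongProxLat.{u})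

/-- Axioms of `⊢_Σ`. -/
inductive SigmaAx : Finset S.carrier → Finset S.carrier → Prop
  | bot : SigmaAx ∅ {⊥}
  | sup (a b) : SigmaAx {a, b} {a ⊔ b}
  | le (a b) : b ≤ a → SigmaAx {a} {b}

/-- Axioms of `⊢_U`. -/
inductive UpperAx : Finset S.carrier → Finset S.carrier → Prop
  | top : UpperAx ∅ {⊤}
  | inf (a b) : UpperAx {a, b} {a ⊓ b}
  | le (a b) : a ≤ b → UpperAx {a} {b}

/-- Axioms of `⊢_L`. -/
inductive LowerAx : Finset S.carrier → Finset S.carrier → Prop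
  | bot : LowerAx {⊥} ∅
  | sup (a b) : LowerAx {a ⊔ b} {a, b}
  | le (a b) : a ≤ b → LowerAx {a} {b}

/-- Axioms of `⊢_D`. -/
inductive DoubleAx : Finset S.carrier → Finset S.carrier → Prop
  | le (a b) : a ≤ b → DoubleAx {a} {b}

variable {S}

theorem gen_multicut {ax : Finset S.carrier → Finset S.carrier → Prop} {A B : Finset S.carrier}
    {x : S.carrier} (h : GenEnt ax A {x}) (h' : GenEnt ax {x} B) : GenEnt ax A B := by
  have hE := GenEnt.isEntailment ax
  exact hE.cut (hE.isUpper.sub h subset_rfl Finset.subset_union_right)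
    (hE.isUpper.sub h' Finset.subset_union_left subset_rfl)

theorem sigma_iff {A B : Finset S.carrier} :
    GenEnt S.SigmaAx A B ↔ ∃ b ∈ B, b ≤ A.sup id := by
  constructor
  · intro h
    refine GenEnt.smallest (E := fun A B => ∃ b ∈ B, b ≤ A.sup id) ⟨?_, ?_, ?_⟩ ?_ h
    · intro a
      exact ⟨a, by simp⟩
    · rintro A B A' B' ⟨b, hb, hle⟩
      exact ⟨b, by simp [hb], hle.trans (Finset.sup_mono Finset.subset_union_right)⟩
    · rintro A B a ⟨b, hb, hle⟩ ⟨c, hc, hle'⟩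
      rcases Finset.mem_union.1 hb with hb | hb
      · exact ⟨b, hb, hle⟩
      · obtain rfl := Finset.mem_singleton.1 hb
        refine ⟨c, hc, hle'.trans ?_⟩
        simpa [Finset.sup_union] using hle
    · rintro A B (_ | ⟨a, b⟩ | ⟨a, b, h⟩)
      · exact ⟨⊥, by simp⟩
      · exact ⟨a ⊔ b, by simp⟩
      · exact ⟨b, by simpa using h⟩
  · rintro ⟨b, hb, hle⟩
    have hE := GenEnt.isEntailment S.SigmaAx
    have key : ∀ A : Finset S.carrier, GenEnt S.SigmaAx A {A.sup id} := by
      intro A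
      induction A using Finset.induction_on with
      | empty => exact .ax .bot
      | insert a A _ ih =>
        refine hE.cut (a := A.sup id)
          (hE.isUpper.sub ih (Finset.subset_insert _ _) Finset.subset_union_right) ?_
        have := GenEnt.ax (SigmaAx.sup (S := S) a (A.sup id))
        rw [Finset.sup_insert]
        refine hE.isUpper.sub this ?_ subset_rfl
        intro x
        simp only [Finset.mem_insert, Finset.mem_union, Finset.mem_singleton]
        tauto
    exact hE.isUpper.sub (gen_multicut (key A) (.ax (.le _ _ hle))) subset_rfl (by simpa using hb)

theorem upper_iff {A B : Finset S.carrier} :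
    GenEnt S.UpperAx A B ↔ ∃ b ∈ B, A.inf id ≤ b := by
  constructor
  · intro h
    refine GenEnt.smallest (E := fun A B => ∃ b ∈ B, A.inf id ≤ b) ⟨?_, ?_, ?_⟩ ?_ h
    · intro a
      exact ⟨a, by simp⟩
    · rintro A B A' B' ⟨b, hb, hle⟩
      exact ⟨b, by simp [hb], (Finset.inf_mono Finset.subset_union_right).trans hle⟩
    · rintro A B a ⟨b, hb, hle⟩ ⟨c, hc, hle'⟩
      rcases Finset.mem_union.1 hb with hb | hb
      · exact ⟨b, hb, hle⟩
      · obtain rfl := Finset.mem_singleton.1 hb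
        refine ⟨c, hc, le_trans ?_ hle'⟩
        simpa [Finset.inf_union] using hle
    · rintro A B (_ | ⟨a, b⟩ | ⟨a, b, h⟩)
      · exact ⟨⊤, by simp⟩
      · exact ⟨a ⊓ b, by simp⟩
      · exact ⟨b, by simpa using h⟩
  · rintro ⟨b, hb, hle⟩
    have hE := GenEnt.isEntailment S.UpperAx
    have key : ∀ A : Finset S.carrier, GenEnt S.UpperAx A {A.inf id} := by
      intro A
      induction A using Finset.induction_on with
      | empty => exact .ax .top
      | insert a A _ ih =>
        refine hE.cut (a := A.inf id)
          (hE.isUpper.sub ih (Finset.subset_insert _ _) Finset.subset_union_right) ?_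
        have := GenEnt.ax (UpperAx.inf (S := S) a (A.inf id))
        rw [Finset.inf_insert]
        refine hE.isUpper.sub this ?_ subset_rfl
        intro x
        simp only [Finset.mem_insert, Finset.mem_union, Finset.mem_singleton]
        tauto
    exact hE.isUpper.sub (gen_multicut (key A) (.ax (.le _ _ hle))) subset_rfl (by simpa using hb)

theorem lower_iff {A B : Finset S.carrier} :
    GenEnt S.LowerAx A B ↔ ∃ a ∈ A, a ≤ B.sup id := by
  constructor
  · intro h
    refine GenEnt.smallest (E := fun A B => ∃ a ∈ A, a ≤ B.sup id) ⟨?_, ?_, ?_⟩ ?_ h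
    · intro a
      exact ⟨a, by simp⟩
    · rintro A B A' B' ⟨a, ha, hle⟩
      exact ⟨a, by simp [ha], hle.trans (Finset.sup_mono Finset.subset_union_left)⟩
    · rintro A B a ⟨b, hb, hle⟩ ⟨c, hc, hle'⟩
      rcases Finset.mem_union.1 hc with hc | hc
      · obtain rfl := Finset.mem_singleton.1 hc
        refine ⟨b, hb, hle.trans ?_⟩
        simpa [Finset.sup_union] using hle'
      · exact ⟨c, hc, hle'⟩
    · rintro A B (_ | ⟨a, b⟩ | ⟨a, b, h⟩)
      · exact ⟨⊥, by simp⟩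
      · exact ⟨a ⊔ b, by simp⟩
      · exact ⟨a, by simpa using h⟩
  · rintro ⟨a, ha, hle⟩
    have hE := GenEnt.isEntailment S.LowerAx
    have key : ∀ B : Finset S.carrier, GenEnt S.LowerAx {B.sup id} B := by
      intro B
      induction B using Finset.induction_on with
      | empty => exact .ax .bot
      | insert b B _ ih =>
        refine hE.cut (a := B.sup id) ?_
          (hE.isUpper.sub ih Finset.subset_union_left (Finset.subset_insert _ _))
        have := GenEnt.ax (LowerAx.sup (S := S) b (B.sup id))
        rw [Finset.sup_insert]
        refine hE.isUpper.sub this subset_rfl ?_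
        intro x
        simp only [Finset.mem_insert, Finset.mem_union, Finset.mem_singleton]
        tauto
    exact hE.isUpper.sub (gen_multicut (.ax (.le _ _ hle)) (key B)) (by simpa using ha) subset_rfl

theorem double_iff {A B : Finset S.carrier} :
    GenEnt S.DoubleAx A B ↔ ∃ a ∈ A, ∃ b ∈ B, a ≤ b := by
  constructor
  · intro h
    refine GenEnt.smallest (E := fun A B => ∃ a ∈ A, ∃ b ∈ B, a ≤ b) ⟨?_, ?_, ?_⟩ ?_ h
    · intro a
      exact ⟨a, by simp, a, by simp⟩
    · rintro A B A' B' ⟨a, ha, b, hb, hle⟩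
      exact ⟨a, by simp [ha], b, by simp [hb], hle⟩
    · rintro A B a ⟨b, hb, c, hc, hle⟩ ⟨d, hd, e, he, hle'⟩
      rcases Finset.mem_union.1 hc with hc | hc
      · exact ⟨b, hb, c, hc, hle⟩
      rcases Finset.mem_union.1 hd with hd | hd
      · obtain rfl := Finset.mem_singleton.1 hc
        obtain rfl := Finset.mem_singleton.1 hd
        exact ⟨b, hb, e, he, hle.trans hle'⟩
      · exact ⟨d, hd, e, he, hle'⟩
    · rintro A B ⟨a, b, h⟩
      exact ⟨a, by simp, b, by simp, h⟩
  · rintro ⟨a, ha, b, hb, hle⟩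
    exact (GenEnt.isEntailment S.DoubleAx).isUpper.sub (.ax (.le _ _ hle)) (by simpa using ha)
      (by simpa using hb)

theorem prec_sup_left {A : Finset S.carrier} {x : S.carrier} (h : ∀ a ∈ A, S.prec a x) :
    S.prec (A.sup id) x := by
  induction A using Finset.induction_on with
  | empty => exact S.isProx.bot_left x
  | insert a A _ ih =>
    rw [Finset.sup_insert]
    exact S.isProx.sup_left (h a (by simp)) (ih fun b hb => h b (by simp [hb]))

theorem prec_inf_right {A : Finset S.carrier} {x : S.carrier} (h : ∀ a ∈ A, S.prec x a) :
    S.prec x (A.inf id) := by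
  induction A using Finset.induction_on with
  | empty => exact S.isProx.top_right x
  | insert a A _ ih =>
    rw [Finset.inf_insert]
    exact S.isProx.inf_right (h a (by simp)) (ih fun b hb => h b (by simp [hb]))

theorem exists_of_prec_sup {A : Finset S.carrier} {x : S.carrier} (h : S.prec x (A.sup id)) :
    ∃ A', lowerExt S.prec A' A ∧ x ≤ A'.sup id := by
  induction A using Finset.induction_on generalizing x with
  | empty =>
    rw [Finset.sup_empty] at h
    exact ⟨∅, by simp [lowerExt], by simp [S.joinPres.prox_zero h]⟩
  | insert a A _ ih =>
    rw [Finset.sup_insert] at h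
    obtain ⟨b, c, hle, hb, hc⟩ := S.joinPres.prox_sup h
    obtain ⟨A', hA', hc'⟩ := ih hc
    refine ⟨insert b A', ?_, ?_⟩
    · intro y hy
      rcases Finset.mem_insert.1 hy with rfl | hy
      · exact ⟨a, by simp, hb⟩
      · obtain ⟨z, hz, hyz⟩ := hA' y hy
        exact ⟨z, by simp [hz], hyz⟩
    · rw [Finset.sup_insert]
      exact hle.trans (sup_le_sup le_rfl hc')

theorem exists_of_inf_prec {A : Finset S.carrier} {x : S.carrier} (h : S.prec (A.inf id) x) :
    ∃ A', upperExt S.prec A A' ∧ A'.inf id ≤ x := by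
  induction A using Finset.induction_on generalizing x with
  | empty =>
    rw [Finset.inf_empty] at h
    exact ⟨∅, by simp [upperExt], by simp [S.prox_one h]⟩
  | insert a A _ ih =>
    rw [Finset.inf_insert] at h
    obtain ⟨b, c, hb, hc, hle⟩ := S.prox_inf h
    obtain ⟨A', hA', hc'⟩ := ih hc
    refine ⟨insert b A', ?_, ?_⟩
    · intro y hy
      rcases Finset.mem_insert.1 hy with rfl | hy
      · exact ⟨a, by simp, hb⟩
      · obtain ⟨z, hz, hyz⟩ := hA' y hy
        exact ⟨z, by simp [hz], hyz⟩
    · rw [Finset.inf_insert]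
      exact (inf_le_inf le_rfl hc').trans hle

theorem prec_sup_mono {A B : Finset S.carrier} (h : lowerExt S.prec A B) :
    S.prec (A.sup id) (B.sup id) :=
  prec_sup_left fun a ha => by
    obtain ⟨b, hb, hab⟩ := h a ha
    exact S.isProx.up_right hab (Finset.le_sup (f := id) hb)

theorem prec_inf_mono {A B : Finset S.carrier} (h : upperExt S.prec A B) :
    S.prec (A.inf id) (B.inf id) :=
  prec_inf_right fun b hb => by
    obtain ⟨a, ha, hab⟩ := h b hb
    exact S.isProx.down_left (Finset.inf_le (f := id) ha) hab

theorem exists_between {a b : S.carrier} (h : S.prec a b) : ∃ c, S.prec a c ∧ S.prec c b :=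
  (S.idem a b).2 h

variable (S)

/-- `Σ(S) = (S, ⊢_Σ, ≻)`. -/
abbrev scott : SContEnt.{u} where
  carrier := S.carrier
  ent := GenEnt S.SigmaAx
  prec := fun a b => S.prec b a
  isEnt := GenEnt.isEntailment _
  idem := fun a c => by
    refine Iff.trans ?_ (S.idem c a)
    exact exists_congr fun b => and_comm
  cont := fun A B => by
    simp only [sigma_iff]
    trans ∃ b ∈ B, S.prec b (A.sup id)
    · constructor
      · rintro ⟨A', hA', b, hb, hle⟩
        exact ⟨b, hb, S.isProx.down_left hle (prec_sup_mono hA')⟩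
      · rintro ⟨b, hb, h⟩
        obtain ⟨A', hA', hle⟩ := exists_of_prec_sup h
        exact ⟨A', hA', b, hb, hle⟩
    · constructor
      · rintro ⟨b, hb, h⟩
        refine ⟨{A.sup id}, ⟨_, Finset.mem_singleton_self _, le_rfl⟩, fun x hx => ⟨b, hb, ?_⟩⟩
        rwa [Finset.mem_singleton.1 hx]
      · rintro ⟨B', ⟨b', hb', hle⟩, hB'⟩
        obtain ⟨b, hb, hbb'⟩ := hB' b' hb'
        exact ⟨b, hb, S.isProx.up_right hbb' hle⟩

/-- `P_U(S) = (S, ⊢_U, ≺)`. -/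
abbrev upper : SContEnt.{u} where
  carrier := S.carrier
  ent := GenEnt S.UpperAx
  prec := S.prec
  isEnt := GenEnt.isEntailment _
  idem := S.idem
  cont := fun A B => by
    simp only [upper_iff]
    trans ∃ b ∈ B, S.prec (A.inf id) b
    · constructor
      · rintro ⟨A', hA', b, hb, hle⟩
        exact ⟨b, hb, S.isProx.up_right (prec_inf_mono hA') hle⟩
      · rintro ⟨b, hb, h⟩
        obtain ⟨A', hA', hle⟩ := exists_of_inf_prec h
        exact ⟨A', hA', b, hb, hle⟩
    · constructor
      · rintro ⟨b, hb, h⟩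
        refine ⟨{A.inf id}, ⟨_, Finset.mem_singleton_self _, le_rfl⟩, fun x hx => ⟨b, hb, ?_⟩⟩
        rwa [Finset.mem_singleton.1 hx]
      · rintro ⟨B', ⟨b', hb', hle⟩, hB'⟩
        obtain ⟨b, hb, hbb'⟩ := hB' b' hb'
        exact ⟨b, hb, S.isProx.down_left hle hbb'⟩

/-- `P_L(S) = (S, ⊢_L, ≺)`. -/
abbrev lower : SContEnt.{u} where
  carrier := S.carrier
  ent := GenEnt S.LowerAx
  prec := S.prec
  isEnt := GenEnt.isEntailment _
  idem := S.idem
  cont := fun A B => by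
    simp only [lower_iff]
    trans ∃ a ∈ A, S.prec a (B.sup id)
    · constructor
      · rintro ⟨A', hA', a', ha', hle⟩
        obtain ⟨a, ha, haa'⟩ := hA' a' ha'
        exact ⟨a, ha, S.isProx.up_right haa' hle⟩
      · rintro ⟨a, ha, h⟩
        refine ⟨{B.sup id}, fun x hx => ⟨a, ha, ?_⟩, ⟨_, Finset.mem_singleton_self _, le_rfl⟩⟩
        rwa [Finset.mem_singleton.1 hx]
    · constructor
      · rintro ⟨a, ha, h⟩
        obtain ⟨B', hB', hle⟩ := exists_of_prec_sup h
        exact ⟨B', ⟨a, ha, hle⟩, hB'⟩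
      · rintro ⟨B', ⟨a, ha, hle⟩, hB'⟩
        exact ⟨a, ha, S.isProx.down_left hle (prec_sup_mono hB')⟩

/-- `P_D(S) = (S, ⊢_D, ≺)`. -/
abbrev double : SContEnt.{u} where
  carrier := S.carrier
  ent := GenEnt S.DoubleAx
  prec := S.prec
  isEnt := GenEnt.isEntailment _
  idem := S.idem
  cont := fun A B => by
    simp only [double_iff]
    trans ∃ a ∈ A, ∃ b ∈ B, S.prec a b
    · constructor
      · rintro ⟨A', hA', a', ha', b, hb, hle⟩
        obtain ⟨a, ha, haa'⟩ := hA' a' ha'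
        exact ⟨a, ha, b, hb, S.isProx.up_right haa' hle⟩
      · rintro ⟨a, ha, b, hb, h⟩
        refine ⟨{b}, fun x hx => ⟨a, ha, ?_⟩, b, by simp, b, hb, le_rfl⟩
        rwa [Finset.mem_singleton.1 hx]
    · constructor
      · rintro ⟨a, ha, b, hb, h⟩
        refine ⟨{a}, ⟨a, ha, a, by simp, le_rfl⟩, fun x hx => ⟨b, hb, ?_⟩⟩
        rwa [Finset.mem_singleton.1 hx]
      · rintro ⟨B', ⟨a, ha, b', hb', hle⟩, hB'⟩
        obtain ⟨b, hb, hbb'⟩ := hB' b' hb'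
        exact ⟨a, ha, b, hb, S.isProx.down_left hle hbb'⟩

end StrongProxLat

end

end DeGroot

/-! Each of the four entailment relations is governed by a single inequality: `A ⊢ B` means that
some `b ∈ B` lies below `⋁A` (for `Σ`), that `⋀A` lies below some `b ∈ B` (for `P_U`), that some `a
∈ A` lies below `⋁B` (for `P_L`), or that some `a ∈ A` lies below some `b ∈ B` (for `P_D`). The
relation `≪` has the same form with `≺` in place of `≤`.

For the first two isomorphisms, send `x` to the generator `of x` of the inner lattice. A generator
lies below a join of generators of `F(Σ(S))` exactly when `{x} ⊢_Σ A`, that is, when some `a ∈ A`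
has `a ≤ x`. Hence the outer `Σ` restricted to generators is `⊢_D`, the two reversals of order
cancelling. Generators suffice: every element of `F(Σ(S))` is a finite join of them, and a join is
equivalent to a conjunction under `⊢_Σ`. The case of `P_U(P_L(S))` is the same with finite meets.
`IsDenseEmbedding` isolates what is needed, and `IsDenseEmbedding.isomorphic` turns such a map into
an isomorphism given by `f(A) ≪ B` and `B ≪ f(A)`.

For the last two, `⊢_Σ` and `⊢_L` are opposite to each other, and so are their relations `≪`. The
passage `𝒰 ↦ 𝒰*` between disjunctive and conjunctive normal forms then makes `F(Σ(S))` and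
`F(P_L(S))` anti-isomorphic (`exists_antiiso`). An anti-isomorphism exchanges meets and joins, hence
the constructions `P_U` and `Σ` (`isomorphic_upper_scott`). -/

namespace DeGroot

open scoped Classical

/-! ### Families of finite sets, their images and the duality `𝒰 ↦ 𝒰*` -/

section Star

variable {S : Type u} {T : Type v}

theorem meets_image_singleton {D C : Finset S} :
    Meets D (C.image fun c => ({c} : Finset S)) ↔ C ⊆ D := by
  simp [Meets, Finset.subset_iff]

theorem meets_singleton {D C : Finset S} : Meets D {C} ↔ ∃ x ∈ C, x ∈ D := by
  simp [Meets]

/-- A set meeting the images of the members of `V` contains the image of a member of `V*`. -/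
theorem Meets.exists_star_image {f : S → T} {V : Finset (Finset S)} {F : Finset T}
    (h : Meets F (V.image (Finset.image f))) : ∃ D ∈ star V, D.image f ⊆ F := by
  -- The part of `⋃V` that `f` maps into `F` already meets every member of `V`.
  have hm : Meets ((V.biUnion id).filter fun x => f x ∈ F) V := by
    intro B hB
    obtain ⟨y, hy, hyF⟩ := h _ (Finset.mem_image_of_mem _ hB)
    obtain ⟨x, hx, rfl⟩ := Finset.mem_image.1 hy
    exact ⟨x, hx, Finset.mem_filter.2 ⟨Finset.mem_biUnion.2 ⟨B, hB, hx⟩, hyF⟩⟩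
  obtain ⟨D, hD, hDs⟩ := hm.exists_star
  refine ⟨D, hD, fun y hy => ?_⟩
  obtain ⟨x, hx, rfl⟩ := Finset.mem_image.1 hy
  exact (Finset.mem_filter.1 (hDs hx)).2

/-- Passing to `𝒰*` turns the extension of a relation into the extension of its opposite. -/
theorem ext_star_star {r r' : Finset S → Finset S → Prop} (hr : IsUpper r)
    (hr' : ∀ A B, r' A B ↔ r B A) {U V : Finset (Finset S)} :
    ext r' (star V) (star U) ↔ ext r U V := by
  constructor
  · intro h A hA D hD
    -- Meeting is symmetric: each member of `U*` meets `A ∈ U`, so `A` contains a member of `U**`.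
    -- Conversely, below, each member of `U**` contains a member of `U`.
    have hm : Meets A (star U) := fun B hB => by
      obtain ⟨x, hx, hxB⟩ := Meets.of_star hB A hA
      exact ⟨x, hxB, hx⟩
    obtain ⟨E, hE, hEA⟩ := hm.exists_star
    exact hr.sub ((hr' _ _).1 (h D hD E hE)) hEA subset_rfl
  · intro h D hD E hE
    obtain ⟨A, hA, hAE⟩ := (Meets.of_star hE).star_star
    exact (hr' _ _).2 (hr.sub (h A hA D hD) hAE subset_rfl)

end Star

/-! ### Composition and interpolation of `≪` -/

namespace SContEnt

variable {X : SContEnt.{u}} {Y : SContEnt.{v}}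

/-- Splitting `B ≪ D` as `B ⊢ B' ≺_L D` lets the union of the sets `B'` absorb `V` through `⊢`;
transitivity of `≺` handles the remaining step. -/
theorem ll_trans {A D : Finset X.carrier} (V : Finset (Finset X.carrier))
    (h : ∀ F ∈ star V, X.ll A F) (h' : ∀ B ∈ V, X.ll B D) : X.ll A D := by
  have h1 : ∀ B ∈ V, ∃ B', X.ent B B' ∧ lowerExt X.prec B' D := fun B hB => ll_iff.1 (h' B hB)
  choose! f hf hf' using h1
  refine ll_lowerExt (ll_ent_trans V (fun F hF => ?_) fun B hB =>
    X.isEnt.isUpper.sub (hf B hB) subset_rfl (Finset.subset_biUnion_of_mem f hB))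
    (lowerExt_biUnion hf')
  obtain ⟨G, hG, hGF⟩ := hF.exists_star
  exact ll_isUpper.sub (h G hG) subset_rfl hGF

/-- Since `≺_L` acts element by element, interpolating in `B ≺_L D` gives an interpolant that is a
plain disjunction of generators. Each disjunct can later be replaced by its own normal form. -/
theorem ll_interp {A D : Finset X.carrier} (h : X.ll A D) :
    ∃ C, X.ll A C ∧ ∀ c ∈ C, X.ll {c} D := by
  obtain ⟨B, hB, hBD⟩ := ll_iff.1 h
  obtain ⟨C, hBC, hCD⟩ := lowerExt_interp hBD
  refine ⟨C, ll_iff.2 ⟨B, hB, hBC⟩, fun c hc => ?_⟩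
  obtain ⟨d, hd, hcd⟩ := hCD c hc
  exact ll_of_prec (Finset.mem_singleton_self c) hd hcd

theorem ent_ll {A B C : Finset X.carrier} {b : X.carrier} (h : X.ent A {b}) (h' : X.ll {b} C)
    (hB : A ⊆ B) : X.ll B C := by
  refine ent_ll_trans {{b}} (fun F hF => X.isEnt.isUpper.sub h hB ?_) (by simpa using h')
  simpa [Meets] using hF

theorem cutComp_ll_ll : cutComp X.ll X.ll = X.ll := by
  funext A D
  refine propext ⟨fun ⟨V, h, h'⟩ => ll_trans V h h', fun h => ?_⟩
  obtain ⟨C, hC, hCD⟩ := ll_interp h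
  -- The disjunction of `C` as a normal form: a set meets all these singletons exactly when it
  -- contains `C`.
  refine ⟨C.image fun c => {c}, fun F hF => ?_, fun B hB => ?_⟩
  · exact ll_isUpper.sub hC subset_rfl (meets_image_singleton.1 (Meets.of_star hF))
  · obtain ⟨c, hc, rfl⟩ := Finset.mem_image.1 hB
    exact hCD c hc

/-- A map between strong continuous entailment relations that preserves and reflects `⊢` and `≪`,
such that every element of the codomain is equivalent to a normal form in values of the map. -/
structure IsDenseEmbedding (X : SContEnt.{u}) (Y : SContEnt.{v}) (f : X.carrier → Y.carrier) :
    Prop where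
  ent_iff : ∀ A B : Finset X.carrier, Y.ent (A.image f) (B.image f) ↔ X.ent A B
  ll_iff : ∀ A B : Finset X.carrier, Y.ll (A.image f) (B.image f) ↔ X.ll A B
  dense : ∀ y, ∃ U : Finset (Finset X.carrier),
    (∀ D, Meets D U → Y.ent {y} (D.image f)) ∧ ∀ A ∈ U, Y.ent (A.image f) {y}

/-! ### Dense embeddings yield isomorphisms -/

namespace IsDenseEmbedding

variable {f : X.carrier → Y.carrier}

/-- The relation `≪` of the codomain interpolates through normal forms in the domain. -/
theorem ll_iff_exists (hf : IsDenseEmbedding X Y f) {P Q : Finset Y.carrier} :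
    (∃ V : Finset (Finset X.carrier), (∀ D ∈ star V, Y.ll P (D.image f)) ∧
      ∀ B ∈ V, Y.ll (B.image f) Q) ↔ Y.ll P Q := by
  constructor
  · rintro ⟨V, h, h'⟩
    refine ll_trans (V.image (Finset.image f)) (fun F hF => ?_) fun B hB => ?_
    · obtain ⟨D, hD, hDF⟩ := (Meets.of_star hF).exists_star_image
      exact ll_isUpper.sub (h D hD) subset_rfl hDF
    · obtain ⟨C, hC, rfl⟩ := Finset.mem_image.1 hB
      exact h' C hC
  · intro h
    obtain ⟨C, hC, hCQ⟩ := ll_interp h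
    choose U hU hU' using hf.dense
    -- The union of the normal forms `U c` represents the join of the interpolants `c`; a set
    -- meeting it meets every `U c`.
    refine ⟨C.biUnion U, fun D hD => ?_, fun B hB => ?_⟩
    · refine ll_ent_trans (C.image fun c => {c})
        (fun F hF => ll_isUpper.sub hC subset_rfl (meets_image_singleton.1 hF)) fun B hB => ?_
      obtain ⟨c, hc, rfl⟩ := Finset.mem_image.1 hB
      exact hU c D fun B hB => Meets.of_star hD B (Finset.mem_biUnion.2 ⟨c, hc, hB⟩)
    · obtain ⟨c, hc, hB⟩ := Finset.mem_biUnion.1 hB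
      exact ent_ll (hU' c B hB) (hCQ c hc) subset_rfl

/-- From `f(A) ⊢ C ≺_L B`, each `c ∈ C` is resolved into its normal form in the domain. Reflection
of `⊢` brings the resulting entailment back to `X`, and each disjunct lies under one `c`, hence `≪`
one `b ∈ B`. -/
theorem isJoinPreserving (hf : IsDenseEmbedding X Y f) :
    IsJoinPreserving X Y fun A B => Y.ll (A.image f) B := by
  intro A B h
  obtain ⟨C, hC, hCB⟩ := SContEnt.ll_iff.1 h
  choose U hU hU' using hf.dense
  refine ⟨C.biUnion U, ?_, fun A' hA' => ?_⟩
  · intro A' hA' D hD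
    obtain rfl := Finset.mem_singleton.1 hA'
    refine (hf.ent_iff _ _).1 (Y.isEnt.trans (C.image fun c => {c})
      (fun F hF => Y.isEnt.isUpper.sub hC subset_rfl (meets_image_singleton.1 hF)) fun B hB => ?_)
    obtain ⟨c, hc, rfl⟩ := Finset.mem_image.1 hB
    exact hU c D fun B hB => Meets.of_star hD B (Finset.mem_biUnion.2 ⟨c, hc, hB⟩)
  · obtain ⟨c, hc, hA'⟩ := Finset.mem_biUnion.1 hA'
    obtain ⟨b, hb, hcb⟩ := hCB c hc
    exact ⟨b, hb, ent_ll (hU' c A' hA') (ll_of_prec (Finset.mem_singleton_self _)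
      (Finset.mem_singleton_self _) hcb) subset_rfl⟩

/-- Density plays no role in this direction: in `B ⊢ C ≺_L f(A)` the set `C` already lives in `Y`,
and each `c ∈ C` is below the image of a single `a ∈ A`. -/
theorem isJoinPreserving_symm (f : X.carrier → Y.carrier) :
    IsJoinPreserving Y X fun B A => Y.ll B (A.image f) := by
  intro B A h
  obtain ⟨C, hC, hCA⟩ := SContEnt.ll_iff.1 h
  refine ⟨C.image fun c => {c}, ?_, fun A' hA' => ?_⟩
  · intro B' hB' D hD
    obtain rfl := Finset.mem_singleton.1 hB'
    exact Y.isEnt.isUpper.sub hC subset_rfl (meets_image_singleton.1 (Meets.of_star hD))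
  · obtain ⟨c, hc, rfl⟩ := Finset.mem_image.1 hA'
    obtain ⟨y, hy, hcy⟩ := hCA c hc
    obtain ⟨a, ha, rfl⟩ := Finset.mem_image.1 hy
    exact ⟨a, ha, ll_of_prec (Finset.mem_singleton_self _) (by simp) hcy⟩

/-- One identity law is idempotence of `≪` on the codomain. The other, after rewriting `≪` of `X` as
`≪` between images, is interpolation through the domain. -/
theorem isProximityMap (hf : IsDenseEmbedding X Y f) :
    IsProximityMap X Y fun A B => Y.ll (A.image f) B where
  upper A A' B B' h :=
    ll_isUpper.sub h (Finset.image_subset_image Finset.subset_union_left) Finset.subset_union_left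
  comp_left := by
    funext A B
    exact congrFun (congrFun cutComp_ll_ll (A.image f)) B
  comp_right := by
    funext A B
    simp only [cutComp, ← hf.ll_iff]
    exact propext hf.ll_iff_exists

theorem isProximityMap_symm (hf : IsDenseEmbedding X Y f) :
    IsProximityMap Y X fun B A => Y.ll B (A.image f) where
  upper A A' B B' h :=
    ll_isUpper.sub h Finset.subset_union_left (Finset.image_subset_image Finset.subset_union_left)
  comp_left := by
    funext A B
    simp only [cutComp, ← hf.ll_iff]
    exact propext hf.ll_iff_exists
  comp_right := by
    funext A B
    exact congrFun (congrFun cutComp_ll_ll A) (B.image f)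

/-- Composing through `Y` is idempotence of `≪` read between images; composing through `X` is
`ll_iff_exists`, where density enters. -/
theorem isomorphic (hf : IsDenseEmbedding X Y f) : Isomorphic X Y := by
  refine ⟨_, _, ⟨hf.isProximityMap, hf.isJoinPreserving⟩,
    ⟨hf.isProximityMap_symm, isJoinPreserving_symm f⟩, ?_, ?_⟩
  · funext A B
    rw [← propext (hf.ll_iff A B)]
    exact congrFun (congrFun cutComp_ll_ll (A.image f)) (B.image f)
  · funext A B
    exact propext hf.ll_iff_exists

end IsDenseEmbedding

/-! ### Generators of the lattice of an entailment relation -/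

namespace EntLat

/-- The element of the lattice given by a generator. -/
noncomputable def of (x : X.carrier) : X.EntLat := mk {{x}}

theorem sup_image_of (A : Finset X.carrier) :
    (A.image of).sup id = (mk (A.image fun a => {a}) : X.EntLat) := by
  induction A using Finset.induction_on with
  | empty => rfl
  | insert a A _ ih =>
    rw [Finset.image_insert, Finset.sup_insert, ih, Finset.image_insert]
    rfl

theorem inf_image_of (A : Finset X.carrier) : (A.image of).inf id = (mk {A} : X.EntLat) := by
  induction A using Finset.induction_on with
  | empty => rfl
  | insert a A _ ih =>
    rw [Finset.image_insert, Finset.inf_insert, ih]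
    change mk (X.meetRep {{a}} {A}) = _
    rw [meetRep, Finset.image₂_singleton]
    rfl

/-- This is the comparison that `⊢_Σ` makes between sets of generators, so it reduces the outer
construction to the inner entailment. The companion `inf_image_of_le_of` does the same for `⊢_U`. -/
theorem of_le_sup_image_of {x : X.carrier} {A : Finset X.carrier} :
    of x ≤ (A.image of).sup id ↔ X.ent {x} A := by
  rw [sup_image_of, of, mk_le, ext_def]
  simp only [Finset.mem_singleton, forall_eq, meets_image_singleton]
  exact ⟨fun h => h A subset_rfl, fun h D hD => X.isEnt.isUpper.sub h subset_rfl hD⟩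

theorem of_prec_sup_image_of {x : X.carrier} {A : Finset X.carrier} :
    prec (of x) ((A.image of).sup id) ↔ X.ll {x} A := by
  rw [sup_image_of, of, prec_mk, ext_ll_def]
  simp only [Finset.mem_singleton, forall_eq, meets_image_singleton]
  exact ⟨fun h => h A subset_rfl, fun h D hD => ll_isUpper.sub h subset_rfl hD⟩

theorem inf_image_of_le_of {x : X.carrier} {A : Finset X.carrier} :
    (A.image of).inf id ≤ of x ↔ X.ent A {x} := by
  rw [inf_image_of, of, mk_le, ext_def]
  simp only [Finset.mem_singleton, forall_eq, meets_singleton, exists_eq_left]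
  exact ⟨fun h => h {x} (Finset.mem_singleton_self x),
    fun h D hD => X.isEnt.isUpper.sub h subset_rfl (Finset.singleton_subset_iff.2 hD)⟩

theorem inf_image_of_prec_of {x : X.carrier} {A : Finset X.carrier} :
    prec ((A.image of).inf id) (of x) ↔ X.ll A {x} := by
  rw [inf_image_of, of, prec_mk, ext_ll_def]
  simp only [Finset.mem_singleton, forall_eq, meets_singleton, exists_eq_left]
  exact ⟨fun h => h {x} (Finset.mem_singleton_self x),
    fun h D hD => ll_isUpper.sub h subset_rfl (Finset.singleton_subset_iff.2 hD)⟩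

end EntLat

/-- If `Y` is the opposite of `X` on the same set of generators, then their lattices are
anti-isomorphic. -/
theorem exists_antiiso {C : Type u} {e e' : Finset C → Finset C → Prop} {p p' : C → C → Prop}
    {h1 h2 h3 h1' h2' h3'}
    (he : ∀ A B, e' A B ↔ e B A)
    (hll : ∀ A B, ll ⟨C, e', p', h1', h2', h3'⟩ A B ↔ ll ⟨C, e, p, h1, h2, h3⟩ B A) :
    ∃ g : EntLat ⟨C, e, p, h1, h2, h3⟩ → EntLat ⟨C, e', p', h1', h2', h3'⟩,
      Function.Surjective g ∧ (∀ a b, g b ≤ g a ↔ a ≤ b) ∧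
      ∀ a b, EntLat.prec (g b) (g a) ↔ EntLat.prec a b := by
  -- With the structures unbundled, both share the carrier `C`, so a normal form over one can be
  -- read over the other.
  let X : SContEnt := ⟨C, e, p, h1, h2, h3⟩
  let Y : SContEnt := ⟨C, e', p', h1', h2', h3'⟩
  have key : ∀ U V : Finset (Finset C), ext e' (star V) (star U) ↔ ext e U V :=
    fun U V => ext_star_star h1.isUpper he
  have key' : ∀ U V : Finset (Finset C), ext Y.ll (star V) (star U) ↔ ext X.ll U V :=
    fun U V => ext_star_star (ll_isUpper (X := X)) hll
  let g : EntLat X → EntLat Y := Quotient.lift (fun U => EntLat.mk (X := Y) (star U)) (by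
    intro U V h
    exact Quotient.sound ⟨(key _ _).2 h.2, (key _ _).2 h.1⟩)
  refine ⟨g, ?_, ?_, ?_⟩
  -- The class of `V*` is a preimage of the class of `V`, because `V**` and `V` are equivalent.
  · refine EntLat.ind fun V => ⟨EntLat.mk (X := X) (star V), ?_⟩
    refine Quotient.sound ⟨?_, ?_⟩
    · intro D hD E hE
      obtain ⟨A, hA, hAE⟩ := (Meets.of_star hD).star_star
      exact Y.isEnt.isUpper.sub (Y.isEnt.ext_refl V A hA E hE) hAE subset_rfl
    · intro A hA E hE
      obtain ⟨D, hD, hDE⟩ := (Meets.of_star hE).star_star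
      obtain ⟨x, hx, hxD⟩ := Meets.of_star hD A hA
      exact Y.isEnt.of_mem hx (hDE hxD)
  · exact EntLat.ind fun U => EntLat.ind fun V => key U V
  · exact EntLat.ind (P := fun a => ∀ b, EntLat.prec (g b) (g a) ↔ EntLat.prec a b)
      fun U => EntLat.ind fun V => key' U V

end SContEnt

/-! ### The constructions `Σ`, `P_U`, `P_L`, `P_D` and their composites -/

namespace StrongProxLat

open SContEnt

variable {S : StrongProxLat.{u}} {A B : Finset S.carrier}

theorem scott_ll : S.scott.ll A B ↔ ∃ b ∈ B, S.prec b (A.sup id) := by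
  simp only [ll, sigma_iff]
  constructor
  · rintro ⟨A', hA', b, hb, hle⟩
    exact ⟨b, hb, S.isProx.down_left hle (prec_sup_mono hA')⟩
  · rintro ⟨b, hb, h⟩
    obtain ⟨A', hA', hle⟩ := exists_of_prec_sup h
    exact ⟨A', hA', b, hb, hle⟩

theorem upper_ll : S.upper.ll A B ↔ ∃ b ∈ B, S.prec (A.inf id) b := by
  simp only [ll, upper_iff]
  constructor
  · rintro ⟨A', hA', b, hb, hle⟩
    exact ⟨b, hb, S.isProx.up_right (prec_inf_mono hA') hle⟩
  · rintro ⟨b, hb, h⟩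
    obtain ⟨A', hA', hle⟩ := exists_of_inf_prec h
    exact ⟨A', hA', b, hb, hle⟩

theorem lower_ll : S.lower.ll A B ↔ ∃ a ∈ A, S.prec a (B.sup id) := by
  -- The form `A ⊢ B' ≺_L B` is chosen because here the join to be split stands on the right.
  simp only [ll_iff, lower_iff]
  constructor
  · rintro ⟨B', ⟨a, ha, hle⟩, hB'⟩
    exact ⟨a, ha, S.isProx.down_left hle (prec_sup_mono hB')⟩
  · rintro ⟨a, ha, h⟩
    obtain ⟨B', hB', hle⟩ := exists_of_prec_sup h
    exact ⟨B', ⟨a, ha, hle⟩, hB'⟩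

theorem double_ll : S.double.ll A B ↔ ∃ a ∈ A, ∃ b ∈ B, S.prec a b := by
  simp only [ll, double_iff]
  constructor
  · rintro ⟨A', hA', a', ha', b, hb, hle⟩
    obtain ⟨a, ha, haa'⟩ := hA' a' ha'
    exact ⟨a, ha, b, hb, S.isProx.up_right haa' hle⟩
  · rintro ⟨a, ha, b, hb, h⟩
    exact ⟨{b}, fun x hx => ⟨a, ha, by rwa [Finset.mem_singleton.1 hx]⟩, b, by simp, b, hb, le_rfl⟩

/-- In the lattice of `Σ(S)`, every element is a finite join of generators. -/
theorem scott_mk_eq_sup (U : Finset (Finset S.carrier)) :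
    (EntLat.mk U : S.scott.EntLat) =
      ((U.image fun A => A.sup id).image (EntLat.of (X := S.scott))).sup id := by
  rw [EntLat.sup_image_of]
  -- Under `⊢_Σ` the conjunction of `A` is equivalent to the single generator `⋁A`, so each disjunct
  -- of `U` collapses to a generator.
  refine Quotient.sound ⟨?_, ?_⟩
  · refine ext_def.2 fun A hA D hD => sigma_iff.2 ⟨A.sup id, ?_, le_rfl⟩
    exact meets_image_singleton.1 hD (Finset.mem_image_of_mem _ hA)
  · refine ext_def.2 fun A hA D hD => sigma_iff.2 ?_
    simp only [Finset.mem_image, exists_exists_and_eq_and] at hA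
    obtain ⟨B, hB, rfl⟩ := hA
    obtain ⟨x, hx, hxD⟩ := hD B hB
    exact ⟨x, hxD, by simpa using Finset.le_sup (f := id) hx⟩

/-- In the lattice of `P_L(S)`, every element is a finite meet of generators. -/
theorem lower_mk_eq_inf (U : Finset (Finset S.carrier)) :
    (EntLat.mk U : S.lower.EntLat) =
      (((star U).image fun A => A.sup id).image (EntLat.of (X := S.lower))).inf id := by
  rw [EntLat.inf_image_of]
  -- `U*` gives the conjunctive form of `U`, and under `⊢_L` each of its disjunctions `D` is
  -- equivalent to the single generator `⋁D`.
  refine Quotient.sound ⟨?_, ?_⟩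
  · refine ext_def.2 fun A hA D hD => lower_iff.2 ?_
    obtain ⟨x, hx, hxD⟩ := meets_singleton.1 hD
    obtain ⟨E, hE, rfl⟩ := Finset.mem_image.1 hx
    obtain ⟨a, ha, haE⟩ := Meets.of_star hE A hA
    exact ⟨a, ha, (Finset.le_sup (f := id) haE).trans (Finset.le_sup (f := id) hxD)⟩
  · intro A hA D hD
    obtain rfl := Finset.mem_singleton.1 hA
    exact lower_iff.2 ⟨D.sup id, Finset.mem_image_of_mem _ hD, le_rfl⟩

/-- `P_D(S) ≅ Σ(Σ(S))`. -/
theorem isDenseEmbedding_double_scott_scott :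
    IsDenseEmbedding S.double S.scott.toProxLat.scott (EntLat.of (X := S.scott)) where
  ent_iff A B := by
    refine sigma_iff.trans (Iff.trans ?_ double_iff.symm)
    simp only [Finset.mem_image, exists_exists_and_eq_and]
    constructor
    · rintro ⟨b, hb, h⟩
      obtain ⟨a, ha, h⟩ := sigma_iff.1 (EntLat.of_le_sup_image_of.1 h)
      exact ⟨a, ha, b, hb, by simpa using h⟩
    · rintro ⟨a, ha, b, hb, h⟩
      exact ⟨b, hb, EntLat.of_le_sup_image_of.2 (sigma_iff.2 ⟨a, ha, by simpa using h⟩)⟩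
  ll_iff A B := by
    refine scott_ll.trans (Iff.trans ?_ double_ll.symm)
    simp only [Finset.mem_image, exists_exists_and_eq_and]
    constructor
    · rintro ⟨b, hb, h⟩
      obtain ⟨a, ha, h⟩ := scott_ll.1 (EntLat.of_prec_sup_image_of.1 h)
      exact ⟨a, ha, b, hb, by simpa using h⟩
    · rintro ⟨a, ha, b, hb, h⟩
      exact ⟨b, hb, EntLat.of_prec_sup_image_of.2 (scott_ll.2 ⟨a, ha, by simpa using h⟩)⟩
  dense := EntLat.ind fun U => by
    rw [scott_mk_eq_sup]
    -- For the outer `⊢_Σ`, a join of generators is equivalent to their conjunction, so one conjunct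
    -- set serves as the normal form.
    refine ⟨{U.image fun A => A.sup id}, fun D hD => sigma_iff.2 ?_, fun A hA => sigma_iff.2 ?_⟩
    · obtain ⟨x, hx, hxD⟩ := meets_singleton.1 hD
      refine ⟨EntLat.of x, Finset.mem_image_of_mem _ hxD, ?_⟩
      rw [Finset.sup_singleton]
      exact Finset.le_sup (f := id) (Finset.mem_image_of_mem _ hx)
    · obtain rfl := Finset.mem_singleton.1 hA
      exact ⟨_, Finset.mem_singleton_self _, le_rfl⟩

/-- `P_D(S) ≅ P_U(P_L(S))`. -/
theorem isDenseEmbedding_double_lower_upper :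
    IsDenseEmbedding S.double S.lower.toProxLat.upper (EntLat.of (X := S.lower)) where
  ent_iff A B := by
    refine upper_iff.trans (Iff.trans ?_ double_iff.symm)
    simp only [Finset.mem_image, exists_exists_and_eq_and]
    constructor
    · rintro ⟨b, hb, h⟩
      obtain ⟨a, ha, h⟩ := lower_iff.1 (EntLat.inf_image_of_le_of.1 h)
      exact ⟨a, ha, b, hb, by simpa using h⟩
    · rintro ⟨a, ha, b, hb, h⟩
      exact ⟨b, hb, EntLat.inf_image_of_le_of.2 (lower_iff.2 ⟨a, ha, by simpa using h⟩)⟩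
  ll_iff A B := by
    refine upper_ll.trans (Iff.trans ?_ double_ll.symm)
    simp only [Finset.mem_image, exists_exists_and_eq_and]
    constructor
    · rintro ⟨b, hb, h⟩
      obtain ⟨a, ha, h⟩ := lower_ll.1 (EntLat.inf_image_of_prec_of.1 h)
      exact ⟨a, ha, b, hb, by simpa using h⟩
    · rintro ⟨a, ha, b, hb, h⟩
      exact ⟨b, hb, EntLat.inf_image_of_prec_of.2 (lower_ll.2 ⟨a, ha, by simpa using h⟩)⟩
  dense := EntLat.ind fun U => by
    rw [lower_mk_eq_inf]
    -- For the outer `⊢_U`, it is a meet of generators that is equivalent to their conjunction.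
    refine ⟨{(star U).image fun A => A.sup id}, fun D hD => upper_iff.2 ?_,
      fun A hA => upper_iff.2 ?_⟩
    · obtain ⟨x, hx, hxD⟩ := meets_singleton.1 hD
      refine ⟨EntLat.of x, Finset.mem_image_of_mem _ hxD, ?_⟩
      rw [Finset.inf_singleton]
      exact Finset.inf_le (f := id) (Finset.mem_image_of_mem _ hx)
    · obtain rfl := Finset.mem_singleton.1 hA
      exact ⟨_, Finset.mem_singleton_self _, le_rfl⟩

/-- An anti-isomorphism between strong proximity lattices identifies the upper construction on
one of them with the Scott construction on the other. -/
theorem isomorphic_upper_scott {L M : StrongProxLat.{u}} (g : L.carrier → M.carrier)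
    (hs : Function.Surjective g) (hle : ∀ a b, g b ≤ g a ↔ a ≤ b)
    (hp : ∀ a b, M.prec (g b) (g a) ↔ L.prec a b) : Isomorphic L.upper M.scott := by
  have hsup : ∀ A : Finset L.carrier, (A.image g).sup id = g (A.inf id) := by
    intro A
    refine le_antisymm (Finset.sup_le fun y hy => ?_) ?_
    · obtain ⟨a, ha, rfl⟩ := Finset.mem_image.1 hy
      exact (hle _ _).2 (Finset.inf_le (f := id) ha)
    -- Surjectivity writes the join as some `g x`; reversing the order turns the claim into `x`
    -- being a lower bound of `A`.
    · obtain ⟨x, hx⟩ := hs ((A.image g).sup id)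
      rw [← hx, hle]
      refine Finset.le_inf fun a ha => ?_
      rw [id, ← hle, hx]
      exact Finset.le_sup (f := id) (Finset.mem_image_of_mem g ha)
  refine IsDenseEmbedding.isomorphic (f := g) ⟨fun A B => ?_, fun A B => ?_, fun y => ?_⟩
  · refine sigma_iff.trans (Iff.trans ?_ upper_iff.symm)
    simp only [hsup, Finset.mem_image, exists_exists_and_eq_and, hle]
  · refine scott_ll.trans (Iff.trans ?_ upper_ll.symm)
    simp only [hsup, Finset.mem_image, exists_exists_and_eq_and, hp]
  -- Every element of the codomain is a value of `g`, so a single generator is a normal form.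
  · obtain ⟨x, rfl⟩ := hs y
    refine ⟨{{x}}, fun D hD => ?_, fun A hA => ?_⟩
    · exact M.scott.isEnt.of_mem (Finset.mem_singleton_self _)
        (Finset.mem_image_of_mem g (by simpa [Meets] using hD))
    · obtain rfl := Finset.mem_singleton.1 hA
      exact M.scott.isEnt.refl (g x)

end StrongProxLat

end DeGroot

open DeGroot DeGroot.SContEnt DeGroot.StrongProxLat in
theorem mainTheorem5 (S : DeGroot.StrongProxLat.{u}) :
    DeGroot.SContEnt.Isomorphic S.double S.scott.toProxLat.scott ∧
    DeGroot.SContEnt.Isomorphic S.double S.lower.toProxLat.upper ∧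
    DeGroot.SContEnt.Isomorphic S.lower.toProxLat.upper S.scott.toProxLat.scott ∧
    DeGroot.SContEnt.Isomorphic S.scott.toProxLat.upper S.lower.toProxLat.scott := by
  -- Interchanging the two sides of `⊢_Σ` gives the condition describing `⊢_L`, and likewise for
  -- `≪`. The anti-isomorphism is taken in both directions, one for each of the last two claims.
  obtain ⟨g, hs, hle, hp⟩ : ∃ g : S.lower.EntLat → S.scott.EntLat,
      Function.Surjective g ∧ (∀ a b, g b ≤ g a ↔ a ≤ b) ∧
      ∀ a b, EntLat.prec (g b) (g a) ↔ EntLat.prec a b :=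
    exists_antiiso (fun _ _ => sigma_iff.trans lower_iff.symm)
      (fun _ _ => scott_ll.trans lower_ll.symm)
  obtain ⟨g', hs', hle', hp'⟩ : ∃ g : S.scott.EntLat → S.lower.EntLat,
      Function.Surjective g ∧ (∀ a b, g b ≤ g a ↔ a ≤ b) ∧
      ∀ a b, EntLat.prec (g b) (g a) ↔ EntLat.prec a b :=
    exists_antiiso (fun _ _ => lower_iff.trans sigma_iff.symm)
      (fun _ _ => lower_ll.trans scott_ll.symm)
  exact ⟨isDenseEmbedding_double_scott_scott.isomorphic,
    isDenseEmbedding_double_lower_upper.isomorphic,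
    isomorphic_upper_scott (L := S.lower.toProxLat) (M := S.scott.toProxLat) g hs hle hp,
    isomorphic_upper_scott (L := S.scott.toProxLat) (M := S.lower.toProxLat) g' hs' hle' hp'⟩
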